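/- Theorem 1.3. Let $X$ be a real or complex Banach space. Write $B(X)$ for the algebra of bounded linear operators on $X$, $K(X)$ for the closed ideal of compact operators, $\dot S$ for the image of $S\in B(X)$ in the Calkin algebra $B(X)/K(X)$, $\|S\|_e$ for the quotient norm of $\dot S$, and $$M_n(\dot T)=\frac{\dot I+\dot T+\cdots+\dot T^{\,n}}{n+1}.$$ Suppose that $X$ has the bounded compact approximation property, i.e. there is a net $(S_\alpha)$ in $K(X)$ with $\sup_\alpha\|S_\alpha\|<\infty$ and $S_\alpha x\to x$ for every $x\in X$. Let $m\ge 1$ be an integer and let $T\in B(X)$ satisfy $\|T^n\|_e/n\to 0$ as $n\to\infty$. Then the following conditions are equivalent. 1. The sequence $(M_n(\dot T))_n$ converges in norm to an element of $B(X)/K(X)$. 2. There is an essentially maximal subspace of $X$ on which $(I-T)^m$ is compact; that is, there is a linear subspace $M\subset X$ such that the restriction of $(I-T)^m$ to $M$ is a compact operator from $M$ to $X$, and such that $\dim M_0/M<\infty$ for every linear subspace $M_0\supset M$ of $X$ for which the restriction of $(I-T)^m$ to $M_0$ is a compact operator from $M_0$ to $X$. -/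

import Mathlib

open Filter Topology

universe u v

/-- The two-sided ideal `K(X)` of compact operators in the algebra `B(X)` of bounded linear
operators on `X`. -/
def compactIdeal (𝕜 : Type u) [RCLike 𝕜] (X : Type v) [NormedAddCommGroup X]
    [NormedSpace 𝕜 X] : Ideal (X →L[𝕜] X) where
  carrier := {K | IsCompactOperator K}
  add_mem' := fun hK hL => hK.add hL
  zero_mem' := isCompactOperator_zero
  smul_mem' := fun S _ hK => hK.clm_comp S

instance compactIdeal_isTwoSided (𝕜 : Type u) [RCLike 𝕜] (X : Type v) [NormedAddCommGroup X]
    [NormedSpace 𝕜 X] : (compactIdeal 𝕜 X).IsTwoSided where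
  mul_mem_of_left S hK := IsCompactOperator.comp_clm hK S

/-- The Calkin algebra `B(X)/K(X)`, with Mathlib's quotient ring structure, quotient scalar
multiplication and quotient norm. -/
abbrev CalkinAlgebra (𝕜 : Type u) [RCLike 𝕜] (X : Type v) [NormedAddCommGroup X]
    [NormedSpace 𝕜 X] : Type v :=
  (X →L[𝕜] X) ⧸ compactIdeal 𝕜 X

/-- The image of a bounded operator in the Calkin algebra. -/
def toCalkin {𝕜 : Type u} [RCLike 𝕜] {X : Type v} [NormedAddCommGroup X]
    [NormedSpace 𝕜 X] (T : X →L[𝕜] X) : CalkinAlgebra 𝕜 X :=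
  Ideal.Quotient.mk (compactIdeal 𝕜 X) T

/-- The essential norm of `T`: the norm of its image in the Calkin algebra. -/
noncomputable def essNorm {𝕜 : Type u} [RCLike 𝕜] {X : Type v} [NormedAddCommGroup X]
    [NormedSpace 𝕜 X] (T : X →L[𝕜] X) : ℝ :=
  ‖toCalkin T‖

/-- The Cesàro mean `M_n(a) = (1 + a + ⋯ + a ^ n) / (n + 1)` in an algebra over `𝕜`. -/
noncomputable def cesaroMean (𝕜 : Type u) [RCLike 𝕜] {A : Type v} [Ring A] [Module 𝕜 A]
    (n : ℕ) (a : A) : A :=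
  ((n : 𝕜) + 1)⁻¹ • ∑ i ∈ Finset.range (n + 1), a ^ i

/-- The bounded compact approximation property: there is a uniformly bounded net of compact
operators converging strongly to the identity. (The index set may always be taken to be the set
of finite-dimensional subspaces of `X`, so its universe is no restriction.) -/
def HasBCAP (𝕜 : Type u) [RCLike 𝕜] (X : Type v) [NormedAddCommGroup X]
    [NormedSpace 𝕜 X] : Prop :=
  ∃ (Λ : Type v) (_ : Preorder Λ) (_ : IsDirectedOrder Λ) (_ : Nonempty Λ)
    (S : Λ → X →L[𝕜] X),
    (∀ α, IsCompactOperator (S α)) ∧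
    (∃ C : ℝ, ∀ α, ‖S α‖ ≤ C) ∧
    ∀ x : X, Tendsto (fun α => S α x) atTop (𝓝 x)

/-- `T` is compact on the subspace `M`: the restriction of `T` to `M`, as an operator from `M`
to `X`, is compact. -/
def IsCompactOn {𝕜 : Type u} [RCLike 𝕜] {X : Type v} [NormedAddCommGroup X]
    [NormedSpace 𝕜 X] (T : X →L[𝕜] X) (M : Submodule 𝕜 X) : Prop :=
  IsCompactOperator (T.comp M.subtypeL)

/-- `M` is an essentially maximal subspace satisfying `P`: it satisfies `P`, and every subspace
`M₀ ⊇ M` satisfying `P` has `dim M₀ / M < ∞`. -/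
def IsEssentiallyMaximal {𝕜 : Type u} [RCLike 𝕜] {X : Type v} [NormedAddCommGroup X]
    [NormedSpace 𝕜 X] (P : Submodule 𝕜 X → Prop) (M : Submodule 𝕜 X) : Prop :=
  P M ∧ ∀ M₀ : Submodule 𝕜 X, M ≤ M₀ → P M₀ →
    FiniteDimensional 𝕜 (M₀ ⧸ M.submoduleOf M₀)

/-!
The two implications are proved by different means.

Suppose that the Cesàro means converge in the Calkin algebra to `p`. Writing `d` for the class of
`1 - T`, one has `d p = p d = 0`, `p ^ 2 = p`, and `1 - p` is a left multiple of `d ^ m`. The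
idempotent `p` lifts to an idempotent operator `f`
(`exists_isIdempotentElem_sub_isCompactOperator`), and the range of `f` is essentially maximal
(`isEssentiallyMaximal_range_of_idempotent`): on a larger subspace on which `(1 - T) ^ m` is compact,
`1 - f` is compact and idempotent, so has finite rank. The lift is obtained without functional
calculus, and so for real scalars too, from a square root of `(2 d' - 1) ^ 2`, where `d'` is a compact
perturbation of a lift of `p`.

Conversely, let `M` be essentially maximal for `S = (1 - T) ^ m`. The compactness of `S` on `M` is
witnessed by a seminorm on all of `X` (`exists_seminorm_isPrecompactBound`), and maximality implies
`dist (x, M) ≤ C (‖S x‖ + p x)` with a function `p` that is small, up to finitely many functionals,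
with respect to the norm (`IsEssentiallyMaximal.exists_norm_mkQ_le`): if this failed, an infinite
biorthogonal sequence could be adjoined to `M` without destroying compactness. Operators act on the
space of bounded families in `X` modulo totally bounded ones, compact operators acting as zero. In
this enlargement the error `p` disappears, and `S` is bounded below modulo its kernel
(`IsEssentiallyMaximal.exists_enlarge_apply_eq_zero`). Since the operator `V` induced by `T` satisfies
`‖V ^ n‖ = o(n)`, a uniform ergodic theorem (`cauchySeq_cesaroMean`) shows that the Cesàro means of
`V` form a Cauchy sequence in norm. The bounded compact approximation property bounds the essential
norm by the norm on the enlargement (`HasBCAP.exists_essNorm_le`), so that the means are Cauchy,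
hence convergent, in the Calkin algebra.
-/

/-! ### Square roots of small and of homotopically trivial perturbations of the identity -/

section SquareRoot

variable {𝕜 : Type*} [RCLike 𝕜] {A : Type*} [NormedRing A] [NormedAlgebra 𝕜 A] [CompleteSpace A]

/-- The square root is `1 + y` with `y` the fixed point of the contraction `y ↦ (x - y ^ 2) / 2`, which
preserves the closed subspace `J`. -/
theorem exists_mul_self_eq_one_add {J : Submodule 𝕜 A} (hJ : IsClosed (J : Set A))
    (hmul : ∀ y ∈ J, y * y ∈ J) {x : A} (hx : x ∈ J) (hx4 : ‖x‖ ≤ 1 / 4) :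
    ∃ y ∈ J, (1 + y) * (1 + y) = 1 + x := by
  let s : Set A := (J : Set A) ∩ Metric.closedBall 0 (1 / 4)
  let f : A → A := fun y => (1 / 2 : 𝕜) • (x - y * y)
  have hhalf : ‖(1 / 2 : 𝕜)‖ = 1 / 2 := by
    rw [norm_div, norm_one, RCLike.norm_ofNat]
  have hs : IsComplete s := (hJ.inter Metric.isClosed_closedBall).isComplete
  have hmaps : Set.MapsTo f s s := by
    rintro y ⟨hyJ, hy⟩
    have hy' : ‖y‖ ≤ 1 / 4 := by simpa using hy
    refine ⟨J.smul_mem _ (J.sub_mem hx (hmul y hyJ)), ?_⟩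
    have h1 : ‖y * y‖ ≤ 1 / 16 := (norm_mul_le y y).trans (by nlinarith [norm_nonneg y])
    have h2 : ‖f y‖ ≤ 1 / 4 := by
      have := norm_sub_le x (y * y)
      simp only [f]
      rw [norm_smul, hhalf]
      linarith
    simpa using h2
  have hc : ContractingWith (1 / 2) (hmaps.restrict f s s) := by
    refine ⟨by norm_num, LipschitzWith.of_dist_le_mul ?_⟩
    rintro ⟨y, hyJ, hy⟩ ⟨z, hzJ, hz⟩
    have hy' : ‖y‖ ≤ 1 / 4 := by simpa using hy
    have hz' : ‖z‖ ≤ 1 / 4 := by simpa using hz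
    rw [Subtype.dist_eq, Subtype.dist_eq, dist_eq_norm, dist_eq_norm]
    change ‖(1 / 2 : 𝕜) • (x - y * y) - (1 / 2 : 𝕜) • (x - z * z)‖ ≤ _
    have h : (1 / 2 : 𝕜) • (x - y * y) - (1 / 2 : 𝕜) • (x - z * z)
        = (-(1 / 2 : 𝕜)) • (y * (y - z) + (y - z) * z) := by
      rw [← smul_sub, neg_smul, ← smul_neg]; congr 1; noncomm_ring
    rw [h, norm_smul, norm_neg, hhalf]
    have h1 := norm_add_le (y * (y - z)) ((y - z) * z)
    have h2 := norm_mul_le y (y - z)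
    have h3 := norm_mul_le (y - z) z
    have h4 := norm_nonneg (y - z)
    simp only [NNReal.coe_div, NNReal.coe_one, NNReal.coe_ofNat]
    nlinarith [mul_le_mul_of_nonneg_right hy' h4, mul_le_mul_of_nonneg_left hz' h4]
  obtain ⟨y, hys, hy, -⟩ := hc.exists_fixedPoint' hs hmaps (x := 0)
    ⟨J.zero_mem, by simp⟩ (edist_ne_top _ _)
  refine ⟨y, hys.1, ?_⟩
  have hy2 : y + y = x - y * y := by
    have : y = (1 / 2 : 𝕜) • (x - y * y) := hy.symm
    calc y + y = (2 : 𝕜) • y := (two_smul 𝕜 y).symm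
      _ = (2 : 𝕜) • ((1 / 2 : 𝕜) • (x - y * y)) := by rw [← this]
      _ = x - y * y := by rw [smul_smul]; norm_num
  calc (1 + y) * (1 + y) = 1 + (y + y) + y * y := by noncomm_ring
    _ = 1 + x := by rw [hy2]; abel

/-- If `1 + s k` is invertible for every `s ∈ [0, 1]`, then `1 + k` has a square root: a fine
subdivision of the segment writes `1 + k` as a product of factors close to `1`, whose square roots
commute. Being free of spectral theory, this holds over `ℝ` as over `ℂ`. -/
theorem exists_mul_self_eq_one_add_of_isUnit_segment {J : Submodule 𝕜 A}
    (hJ : IsClosed (J : Set A)) (hmul : ∀ y ∈ J, ∀ z ∈ J, y * z ∈ J)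
    (hcomm : ∀ y ∈ J, ∀ z ∈ J, Commute y z) {k : A}
    (hunit : ∀ s ∈ Set.Icc (0 : ℝ) 1, IsUnit (1 + (s : 𝕜) • k))
    (hk : ∀ s ∈ Set.Icc (0 : ℝ) 1, k * Ring.inverse (1 + (s : 𝕜) • k) ∈ J) :
    ∃ y ∈ J, (1 + y) * (1 + y) = 1 + k := by
  obtain ⟨B, hB⟩ : ∃ B, ∀ s ∈ Set.Icc (0 : ℝ) 1, ‖k * Ring.inverse (1 + (s : 𝕜) • k)‖ ≤ B := by
    refine isCompact_Icc.exists_bound_of_continuousOn ?_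
    intro s hs
    have h1 : Continuous fun s : ℝ => 1 + (s : 𝕜) • k := by fun_prop
    have h2 : ContinuousAt (Ring.inverse : A → A) (1 + (s : 𝕜) • k) := by
      obtain ⟨w, hw⟩ := hunit s hs
      rw [← hw]
      exact NormedRing.inverse_continuousAt w
    exact (continuousAt_const.mul
      (ContinuousAt.comp (f := fun s : ℝ => 1 + (s : 𝕜) • k) h2 h1.continuousAt)).continuousWithinAt
  -- With this mesh each quotient `(1 + (s + 1/n) k) / (1 + s k)` is within `1/4` of `1`.
  obtain ⟨n, hn⟩ := exists_nat_gt (4 * B)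
  have hn0 : (0 : ℝ) < n := by
    have := (norm_nonneg _).trans (hB 0 (by simp))
    linarith
  have key : ∀ j : ℕ, j ≤ n →
      ∃ y ∈ J, (1 + y) * (1 + y) = 1 + (((j / n : ℝ)) : 𝕜) • k := by
    intro j
    induction j with
    | zero => intro _; exact ⟨0, J.zero_mem, by simp⟩
    | succ j ih =>
      intro hj
      obtain ⟨y, hyJ, hy⟩ := ih (by omega)
      have hs : (j / n : ℝ) ∈ Set.Icc (0 : ℝ) 1 := by
        refine ⟨by positivity, (div_le_one hn0).2 ?_⟩
        exact_mod_cast (by omega : j ≤ n)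
      set s : ℝ := j / n
      set g := Ring.inverse (1 + (s : 𝕜) • k)
      have hg : (1 + (s : 𝕜) • k) * g = 1 := Ring.mul_inverse_cancel _ (hunit s hs)
      obtain ⟨z, hzJ, hz⟩ := exists_mul_self_eq_one_add (𝕜 := 𝕜) hJ (fun y hy => hmul y hy y hy)
        (J.smul_mem (((n : ℝ)⁻¹ : ℝ) : 𝕜) (hk s hs)) (by
          rw [norm_smul, RCLike.norm_ofReal, abs_of_pos (inv_pos.2 hn0), inv_mul_le_iff₀ hn0]
          have := hB s hs
          linarith)
      refine ⟨y + z + y * z, J.add_mem (J.add_mem hyJ hzJ) (hmul y hyJ z hzJ), ?_⟩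
      have hyz : (1 + y) * (1 + z) = (1 + z) * (1 + y) := by
        have := (hcomm y hyJ z hzJ).eq
        rw [mul_add, add_mul, mul_add, add_mul, this]; noncomm_ring
      have h1 : (1 + (y + z + y * z)) = (1 + y) * (1 + z) := by noncomm_ring
      have h2 : (1 + (s : 𝕜) • k) * (k * g) = k := by
        have : (1 + (s : 𝕜) • k) * k = k * (1 + (s : 𝕜) • k) := by
          rw [add_mul, mul_add, smul_mul_assoc, mul_smul_comm, one_mul, mul_one]
        rw [← mul_assoc, this, mul_assoc, hg, mul_one]
      rw [h1]
      calc (1 + y) * (1 + z) * ((1 + y) * (1 + z))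
          = (1 + y) * ((1 + z) * (1 + y)) * (1 + z) := by simp only [mul_assoc]
        _ = ((1 + y) * (1 + y)) * ((1 + z) * (1 + z)) := by rw [← hyz]; simp only [mul_assoc]
        _ = (1 + (s : 𝕜) • k) + (((n : ℝ)⁻¹ : ℝ) : 𝕜) • k := by
          rw [hy, hz, mul_add, mul_one, mul_smul_comm, h2]
        _ = 1 + (((((j + 1 : ℕ) : ℝ) / n : ℝ)) : 𝕜) • k := by
          rw [add_assoc, ← add_smul, ← RCLike.ofReal_add]
          congr 3
          simp only [s]
          push_cast
          field_simp
  obtain ⟨y, hyJ, hy⟩ := key n le_rfl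
  refine ⟨y, hyJ, ?_⟩
  rw [hy, div_self hn0.ne']
  simp

end SquareRoot

/-! ### Lifting idempotents modulo the compact operators -/

section IdempotentLifting

variable {𝕜 : Type*} [RCLike 𝕜] {E : Type*} [NormedAddCommGroup E] [NormedSpace 𝕜 E]

/-- The argument of F. Riesz: a compact operator admits no strictly increasing chain of closed
invariant subspaces `F n` such that `1 + k ∘ c n` maps `F (n + 1)` into `F n`, with the `c n`
uniformly bounded. -/
theorem not_strictMono_of_isCompactOperator_of_add_comp_mem {k : E →L[𝕜] E}
    (hk : IsCompactOperator k) (F : ℕ → Submodule 𝕜 E) (hF : ∀ n, IsClosed (F n : Set E))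
    (hmono : Monotone F) (hne : ∀ n, ∃ x ∈ F (n + 1), x ∉ F n)
    (hkF : ∀ n, ∀ x ∈ F n, k x ∈ F n) (c : ℕ → E →L[𝕜] E) {B : ℝ} (hB : ∀ n, ‖c n‖ ≤ B)
    (hcF : ∀ n, ∀ x ∈ F (n + 1), c n x ∈ F (n + 1))
    (h : ∀ n, ∀ x ∈ F (n + 1), x + k (c n x) ∈ F n) : False := by
  have hz : ∀ n, ∃ z ∈ F (n + 1), ‖z‖ = 1 ∧ ∀ y ∈ F n, 1 / 2 ≤ ‖z - y‖ := by
    intro n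
    have h1 : IsClosed ((F n).comap (F (n + 1)).subtype : Set (F (n + 1))) := by
      simpa using! (hF n).preimage_val
    obtain ⟨x, hx, hxn⟩ := hne n
    obtain ⟨⟨z, hzm⟩, -, hz1, hz2⟩ := riesz_lemma_of_lt_one (𝕜 := 𝕜) h1 ⟨⟨x, hx⟩, hxn⟩
      (r := 1 / 2) (by norm_num)
    exact ⟨z, hzm, hz1, fun y hy => hz2 ⟨y, hmono (Nat.le_succ n) hy⟩ hy⟩
  choose z hzF hz1 hz2 using hz
  obtain ⟨K, hK, hKs⟩ := hk.image_closedBall_subset_compact B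
  obtain ⟨a, -, ψ, hψ, hψa⟩ := hK.tendsto_subseq (x := fun n => k (c n (z n))) (fun n =>
    hKs ⟨c n (z n), by
      have := (c n).le_opNorm (z n)
      rw [hz1, mul_one] at this
      simpa using this.trans (hB n), rfl⟩)
  have hsep : ∀ m n, m < n → 1 / 2 ≤ ‖k (c n (z n)) - k (c m (z m))‖ := by
    intro m n hmn
    have h1 : k (c m (z m)) ∈ F n :=
      hmono hmn (hkF _ _ (hcF m _ (hzF m)))
    have h2 := hz2 n ((z n + k (c n (z n))) - k (c m (z m)))
      ((F n).sub_mem (h n _ (hzF n)) h1)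
    rwa [show z n - ((z n + k (c n (z n))) - k (c m (z m)))
      = -(k (c n (z n)) - k (c m (z m))) by abel, norm_neg] at h2
  have hC := hψa.cauchySeq
  rw [Metric.cauchySeq_iff'] at hC
  obtain ⟨N, hN⟩ := hC (1 / 2) (by norm_num)
  have h1 := hN (N + 1) (Nat.le_succ N)
  rw [dist_eq_norm] at h1
  exact absurd h1 (not_lt.2 (hsep _ _ (hψ (Nat.lt_succ_self N))))

open Polynomial in
/-- The polynomial `1 + 4 s (d ^ 2 - d)`, where `d = X + t (X ^ 2 - X)`. For an almost idempotent
`e`, the parameter `t` perturbs `e` by a compact operator, and `s` runs along the segment from `1`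
to `(2 d - 1) ^ 2`. -/
noncomputable def shiftedDiscriminant (t s : ℝ) : ℝ[X] :=
  1 + C (4 * s) * ((X + C t * (X ^ 2 - X)) ^ 2 - (X + C t * (X ^ 2 - X)))

open Polynomial in
/-- At a complex root `a`, the number `w = a + t (a ^ 2 - a)` solves `1 + 4 s (w ^ 2 - w) = 0`, which
for `s ∈ [0, 1]` forces `Re w = 1 / 2`. If two distinct `t` shared a root `a`, then
`Re (a ^ 2 - a) = 0` and `Re a = 1 / 2`, which is impossible. -/
theorem isCoprime_shiftedDiscriminant {t t' s s' : ℝ} (hs : s ∈ Set.Icc (0 : ℝ) 1)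
    (hs' : s' ∈ Set.Icc (0 : ℝ) 1) (ht : t ≠ t') :
    IsCoprime (shiftedDiscriminant t s) (shiftedDiscriminant t' s') := by
  rw [isCoprime_iff_aeval_ne_zero_of_isAlgClosed ℝ ℂ]
  have hre : ∀ {t s : ℝ}, s ∈ Set.Icc (0 : ℝ) 1 → ∀ a : ℂ,
      aeval a (shiftedDiscriminant t s) = 0 → a.re + t * (a ^ 2 - a).re = 1 / 2 := by
    intro t s hs a h
    obtain ⟨w, hw⟩ : ∃ w, w = a + t * (a ^ 2 - a) := ⟨_, rfl⟩
    have h1 : 1 + 4 * (s : ℂ) * (w ^ 2 - w) = 0 := by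
      rw [hw]; simpa [shiftedDiscriminant, mul_assoc] using h
    have h2 : a.re + t * (a ^ 2 - a).re = w.re := by rw [hw]; simp
    rw [h2]
    have hr := congrArg Complex.re h1
    have hi := congrArg Complex.im h1
    simp [pow_two] at hr hi
    rcases eq_or_ne s 0 with rfl | hs0
    · simp at hr
    · have hspos : 0 < s := lt_of_le_of_ne hs.1 hs0.symm
      have h3 : w.re * w.im + w.im * w.re - w.im = 0 := by
        rcases hi with h | h
        · exact absurd h hs0
        · exact h
      have h4 : w.im * (2 * w.re - 1) = 0 := by linarith
      rcases mul_eq_zero.1 h4 with h5 | h5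
      · rw [h5] at hr
        nlinarith [mul_nonneg hspos.le (sq_nonneg (2 * w.re - 1)), hs.2]
      · linarith
  intro a
  by_contra! hcon
  have e1 := hre hs a hcon.1
  have e2 := hre hs' a hcon.2
  have e3 : (a ^ 2 - a).re = 0 := by
    have : (t - t') * (a ^ 2 - a).re = 0 := by linarith
    exact (mul_eq_zero.1 this).resolve_left (sub_ne_zero.2 ht)
  rw [e3] at e1
  simp [pow_two] at e3
  nlinarith [sq_nonneg a.im]

open Polynomial in
theorem aeval_map_shiftedDiscriminant (e : E →L[𝕜] E) (t s : ℝ) :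
    aeval e ((shiftedDiscriminant t s).map (algebraMap ℝ 𝕜)) =
      1 + ((4 * s : ℝ) : 𝕜) • ((e + (t : 𝕜) • (e * e - e)) * (e + (t : 𝕜) • (e * e - e)) -
        (e + (t : 𝕜) • (e * e - e))) := by
  have hgen : ∀ a b : 𝕜,
      aeval e (1 + C a * ((X + C b * (X ^ 2 - X)) ^ 2 - (X + C b * (X ^ 2 - X)))) =
      1 + a • ((e + b • (e * e - e)) * (e + b • (e * e - e)) - (e + b • (e * e - e))) := by
    intro a b
    simp only [map_mul, map_add, map_sub, aeval_C, aeval_X, map_one, pow_two,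
      Algebra.algebraMap_eq_smul_one, smul_mul_assoc, one_mul]
  rw [← hgen, shiftedDiscriminant]
  simp only [Polynomial.map_sub, Polynomial.map_add, Polynomial.map_mul, Polynomial.map_pow,
    Polynomial.map_one, map_C, map_X, RCLike.algebraMap_eq_ofReal]

open Polynomial in
/-- Some shift `t` makes `1 + 4 s (d ^ 2 - d)` injective for all `s ∈ [0, 1]` at once. If every
`t n = 1 / (n + 1)` failed, the kernels of the products of the corresponding pairwise coprime
polynomials would form a chain of the kind that compactness of `e ^ 2 - e` excludes. -/
theorem exists_shiftedDiscriminant_injective {e : E →L[𝕜] E} (he : IsCompactOperator (e * e - e)) :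
    ∃ t : ℝ, ∀ s ∈ Set.Icc (0 : ℝ) 1, ∀ x : E,
      aeval e ((shiftedDiscriminant t s).map (algebraMap ℝ 𝕜)) x = 0 → x = 0 := by
  by_contra! hcon
  set t : ℕ → ℝ := fun n => 1 / ((n : ℝ) + 1) with ht
  choose s hs x hx hx0 using fun n => hcon (t n)
  set p : ℕ → 𝕜[X] := fun n => (shiftedDiscriminant (t n) (s n)).map (algebraMap ℝ 𝕜) with hp
  set F : ℕ → Submodule 𝕜 E := fun n =>
    LinearMap.ker (aeval e (∏ i ∈ Finset.range n, p i) : E →L[𝕜] E).toLinearMap with hFdef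
  have hmem : ∀ n y, y ∈ F n ↔ aeval e (∏ i ∈ Finset.range n, p i) y = 0 := fun n y => Iff.rfl
  have hinj : Function.Injective t := by
    intro m n hmn
    simpa [ht] using hmn
  have hstep : ∀ n y, y ∈ F (n + 1) → aeval e (p n) y ∈ F n := by
    intro n y hy
    rw [hmem] at hy ⊢
    rwa [Finset.prod_range_succ, map_mul] at hy
  have hinv : ∀ (q : 𝕜[X]) n y, y ∈ F n → aeval e q y ∈ F n := by
    intro q n y hy
    rw [hmem] at hy ⊢
    rw [← mul_apply_eq_comp, ← map_mul, mul_comm, map_mul,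
      mul_apply_eq_comp, hy, map_zero]
  have hsucc : ∀ n, F n ≤ F (n + 1) := by
    intro n y hy
    rw [hmem] at hy ⊢
    rw [Finset.prod_range_succ, mul_comm, map_mul, mul_apply_eq_comp, hy, map_zero]
  have hxmem : ∀ n, x n ∈ F (n + 1) := by
    intro n
    rw [hmem, Finset.prod_range_succ, map_mul, mul_apply_eq_comp, hx, map_zero]
  have hxnot : ∀ n, x n ∉ F n := by
    intro n hxn
    have hcop : IsCoprime (∏ i ∈ Finset.range n, p i) (p n) := by
      refine IsCoprime.prod_left fun i hi => ?_
      exact (isCoprime_shiftedDiscriminant (hs i) (hs n)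
        (fun h => (Finset.mem_range.1 hi).ne (hinj h))).map (mapRingHom (algebraMap ℝ 𝕜))
    obtain ⟨a, b, hab⟩ := hcop
    apply hx0 n
    have h1 := congrArg (fun q : 𝕜[X] => aeval e q (x n)) hab
    simp only [map_add, map_mul, map_one, add_apply,
      mul_apply_eq_comp, one_apply_eq_self] at h1
    rw [← h1, (hmem n _).1 hxn, hx]
    simp
  -- `p n = 1 + (X ^ 2 - X) q n`, so `p n` acts as the identity plus `e ^ 2 - e` times a
  -- bounded factor.
  let q : ℕ → 𝕜[X] := fun n => C ((4 * s n : ℝ) : 𝕜) *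
    (1 - C ((t n : ℝ) : 𝕜) + C ((2 * t n : ℝ) : 𝕜) * X + C ((t n ^ 2 : ℝ) : 𝕜) * (X ^ 2 - X))
  have hpq : ∀ n, p n = 1 + (X ^ 2 - X) * q n := by
    intro n
    have h4 : C ((4 * s n : ℝ) : 𝕜) = 4 * C ((s n : ℝ) : 𝕜) := by
      push_cast; rw [C_mul, map_ofNat C 4]
    have h2 : C ((2 * t n : ℝ) : 𝕜) = 2 * C ((t n : ℝ) : 𝕜) := by
      push_cast; rw [C_mul, map_ofNat C 2]
    have h1 : C ((t n ^ 2 : ℝ) : 𝕜) = C ((t n : ℝ) : 𝕜) ^ 2 := by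
      push_cast; rw [C_pow]
    simp only [hp, q, shiftedDiscriminant, Polynomial.map_sub, Polynomial.map_add,
      Polynomial.map_mul, Polynomial.map_pow, Polynomial.map_one, map_C, map_X,
      RCLike.algebraMap_eq_ofReal, h4, h2, h1]
    ring
  have haev : aeval e (X ^ 2 - X : 𝕜[X]) = e * e - e := by simp [pow_two]
  have htn : ∀ n, 0 ≤ t n ∧ t n ≤ 1 := by
    intro n
    refine ⟨by simp only [ht]; positivity, ?_⟩
    simp only [ht]
    rw [div_le_one (by positivity)]
    linarith [(Nat.cast_nonneg n : (0 : ℝ) ≤ n)]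
  have hB : ∀ n, ‖aeval e (q n)‖ ≤ 4 * (‖(1 : E →L[𝕜] E)‖ + ‖(1 : E →L[𝕜] E)‖ + 2 * ‖e‖ +
      ‖e * e - e‖) := by
    intro n
    have hq : aeval e (q n) = ((4 * s n : ℝ) : 𝕜) • (1 - ((t n : ℝ) : 𝕜) • 1 +
        ((2 * t n : ℝ) : 𝕜) • e + ((t n ^ 2 : ℝ) : 𝕜) • (e * e - e)) := by
      have hgen : ∀ a b c d : 𝕜, aeval e (C a * (1 - C b + C c * X + C d * (X ^ 2 - X))) =
          a • (1 - b • 1 + c • e + d • (e * e - e)) := by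
        intro a b c d
        rw [map_mul, map_add, map_add, map_mul, map_mul, haev]
        simp only [map_sub, aeval_C, aeval_X, map_one, Algebra.algebraMap_eq_smul_one,
          smul_mul_assoc, one_mul]
      exact hgen _ _ _ _
    obtain ⟨h0, h1⟩ := htn n
    obtain ⟨h2, h3⟩ := hs n
    rw [hq, norm_smul, RCLike.norm_ofReal, abs_of_nonneg (by linarith)]
    refine mul_le_mul (by linarith) ?_ (norm_nonneg _) (by norm_num)
    refine (norm_add_le _ _).trans (add_le_add ((norm_add_le _ _).trans (add_le_add
      ((norm_sub_le _ _).trans (add_le_add le_rfl ?_)) ?_)) ?_)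
    all_goals rw [norm_smul, RCLike.norm_ofReal, abs_of_nonneg (by positivity)]
    · exact mul_le_of_le_one_left (norm_nonneg _) h1
    · exact mul_le_mul_of_nonneg_right (by linarith) (norm_nonneg _)
    · exact mul_le_of_le_one_left (norm_nonneg _) (by nlinarith)
  refine not_strictMono_of_isCompactOperator_of_add_comp_mem he F
    (fun n => ContinuousLinearMap.isClosed_ker _)
    (monotone_nat_of_le_succ hsucc) (fun n => ⟨x n, hxmem n, hxnot n⟩) (fun n y hy => ?_)
    (fun n => aeval e (q n)) hB (fun n y hy => hinv _ _ _ hy) (fun n y hy => ?_)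
  · rw [← haev]; exact hinv _ _ _ hy
  · have := hstep n y hy
    rw [hpq, map_add, map_one, map_mul, haev] at this
    exact this

/-- The Fredholm alternative. -/
theorem isUnit_one_add_of_isCompactOperator [CompleteSpace E] {k : E →L[𝕜] E}
    (hk : IsCompactOperator k) (h : ∀ x, (1 + k) x = 0 → x = 0) : IsUnit (1 + k) := by
  have hk' : IsCompactOperator (-k) := hk.neg
  rcases hk'.hasEigenvalue_or_mem_resolventSet (μ := (1 : 𝕜)) one_ne_zero with h1 | h1
  · obtain ⟨x, hx⟩ := h1.exists_hasEigenvector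
    refine absurd (h x ?_) hx.2
    have := hx.apply_eq_smul
    simp only [one_smul] at this
    have h2 : -k x = x := this
    rw [add_apply, one_apply_eq_self]
    nth_rewrite 1 [← h2]
    simp
  · rw [spectrum.mem_resolventSet_iff] at h1
    simpa using h1

/-- Idempotents of the Calkin algebra lift to idempotent operators. With `d` a compact perturbation
of `e` such that `1 + 4 s (d ^ 2 - d)` is invertible for `s ∈ [0, 1]`, the element `u = 2 d - 1` has
`u ^ 2 = v ^ 2` where `v` is a compact perturbation of `1` that commutes with `u`, and
`(1 + u v⁻¹) / 2` is the lift. -/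
theorem exists_isIdempotentElem_sub_isCompactOperator [CompleteSpace E] {e : E →L[𝕜] E}
    (he : IsCompactOperator (e * e - e)) :
    ∃ f : E →L[𝕜] E, f * f = f ∧ IsCompactOperator (f - e) := by
  obtain ⟨t, ht⟩ := exists_shiftedDiscriminant_injective he
  have hleft : ∀ {a b : E →L[𝕜] E}, IsCompactOperator b → IsCompactOperator (a * b) :=
    fun {a b} hb => hb.clm_comp a
  have hright : ∀ {a b : E →L[𝕜] E}, IsCompactOperator a → IsCompactOperator (a * b) :=
    fun {a b} ha => ha.comp_clm b
  set d : E →L[𝕜] E := e + (t : 𝕜) • (e * e - e) with hd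
  have hde : Commute d e := by
    refine (Commute.refl e).add_left (Commute.smul_left ?_ _)
    exact ((Commute.refl e).mul_left (Commute.refl e)).sub_left (Commute.refl e)
  have hdcomp : IsCompactOperator (d - e) := by
    rw [hd, add_sub_cancel_left]
    exact he.smul (t : 𝕜)
  have hK : IsCompactOperator (d * d - d) := by
    have : d * d - d = (e * e - e) + (d - e) * d + e * (d - e) - (d - e) := by noncomm_ring
    rw [this]
    exact ((he.add (hright hdcomp)).add (hleft hdcomp)).sub hdcomp
  set k : E →L[𝕜] E := (4 : 𝕜) • (d * d - d) with hkdef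
  have hk : IsCompactOperator k := hK.smul (4 : 𝕜)
  have hunit : ∀ s ∈ Set.Icc (0 : ℝ) 1, IsUnit (1 + (s : 𝕜) • k) := by
    intro s hs
    refine isUnit_one_add_of_isCompactOperator (hk.smul (s : 𝕜)) fun x hx => ht s hs x ?_
    have : Polynomial.aeval e ((shiftedDiscriminant t s).map (algebraMap ℝ 𝕜))
        = 1 + (s : 𝕜) • k := by
      rw [aeval_map_shiftedDiscriminant, hkdef, smul_smul, RCLike.ofReal_mul,
        RCLike.ofReal_ofNat, mul_comm]
    rw [this]
    exact hx
  -- The compact operators in the bicommutant of `e`: a closed commutative algebra that contains all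
  -- the operators whose square roots are taken.
  let J : Submodule 𝕜 (E →L[𝕜] E) := compactOperator (RingHom.id 𝕜) E E ⊓
    (Subalgebra.centralizer 𝕜 (Set.centralizer {e})).toSubmodule
  have hJmem : ∀ y, y ∈ J ↔ IsCompactOperator y ∧ ∀ c, Commute e c → Commute c y := by
    intro y
    refine and_congr Iff.rfl ⟨fun h c hc => h c ?_, fun h c hc => h c (hc e rfl)⟩
    rintro _ rfl
    exact hc
  have hJclosed : IsClosed (J : Set (E →L[𝕜] E)) := by
    refine IsClosed.inter isClosed_setOfPred_isCompactOperator ?_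
    exact Set.isClosed_centralizer _
  have hkcomm : ∀ c, Commute e c → Commute c k := by
    intro c hc
    have hcd : Commute c d := hc.symm.add_right (Commute.smul_right
      ((hc.symm.mul_right hc.symm).sub_right hc.symm) _)
    exact Commute.smul_right ((hcd.mul_right hcd).sub_right hcd) _
  have hself : ∀ {y}, y ∈ J → Commute e y := fun {y} hy => ((hJmem y).1 hy).2 e (Commute.refl e)
  obtain ⟨y, hyJ, hy⟩ := exists_mul_self_eq_one_add_of_isUnit_segment (𝕜 := 𝕜) (J := J) (k := k)
    hJclosed (fun y hy z hz => (hJmem _).2 ⟨hright ((hJmem y).1 hy).1, fun c hc =>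
      (((hJmem y).1 hy).2 c hc).mul_right (((hJmem z).1 hz).2 c hc)⟩)
    (fun y hy z hz => ((hJmem z).1 hz).2 y (hself hy)) hunit
    (fun s hs => (hJmem _).2 ⟨hright hk, fun c hc => by
      obtain ⟨w, hw⟩ := hunit s hs
      have h1 : Commute c (w : E →L[𝕜] E) := by
        rw [hw]; exact (Commute.one_right c).add_right (Commute.smul_right (hkcomm c hc) _)
      rw [← hw, Ring.inverse_unit]
      exact (hkcomm c hc).mul_right h1.units_inv_right⟩)
  obtain ⟨hycomp, hycomm⟩ := (hJmem y).1 hyJ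
  obtain ⟨v, hv⟩ : IsUnit (1 + y) := by
    have h1 : IsUnit ((1 + y) * (1 + y)) := by
      rw [hy]; simpa using hunit 1 (by simp)
    exact ((Commute.refl (1 + y)).isUnit_mul_iff.1 h1).1
  set u : E →L[𝕜] E := 2 * d - 1 with hu
  have huu : u * u = v * v := by
    have : (4 : 𝕜) • (d * d - d) = 4 * (d * d - d) := by
      rw [← map_ofNat (algebraMap 𝕜 (E →L[𝕜] E)) 4, Algebra.smul_def]
    rw [hv, hy, hkdef, this, hu]
    noncomm_ring
  have huv : Commute u (v : E →L[𝕜] E) := by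
    rw [hv]
    have h1 : Commute d y := hycomm d hde.symm
    exact (Commute.one_right u).add_right
      (((Commute.ofNat_left 2 y).mul_left h1).sub_left (Commute.one_left y))
  set w : E →L[𝕜] E := ((v⁻¹ : (E →L[𝕜] E)ˣ) : E →L[𝕜] E) with hw
  have huw : u * w = w * u := huv.units_inv_right
  have hvw : (v : E →L[𝕜] E) * w = 1 := v.mul_inv
  have hwv : w * (v : E →L[𝕜] E) = 1 := v.inv_mul
  have hsq : (u * w) * (u * w) = 1 := by
    calc (u * w) * (u * w) = (w * u) * (u * w) := by rw [huw]
      _ = w * (u * u) * w := by simp only [mul_assoc]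
      _ = (w * v) * (v * w) := by rw [huu]; simp only [mul_assoc]
      _ = 1 := by rw [hwv, hvw, one_mul]
  refine ⟨(1 / 2 : 𝕜) • (1 + u * w), ?_, ?_⟩
  · rw [smul_mul_smul_comm, add_mul, mul_add, mul_add, hsq, one_mul, mul_one, one_mul,
      show (1 + u * w + (u * w + 1) : E →L[𝕜] E) = (2 : 𝕜) • (1 + u * w) by
        rw [two_smul]; abel, smul_smul]
    norm_num
  · have h1 : (1 / 2 : 𝕜) • (1 + u * w) - e = (d - e) - (1 / 2 : 𝕜) • (u * w * y) := by
      have h2 : u * w * y = u - u * w := by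
        have : y = v - 1 := by rw [hv]; abel
        rw [this, mul_sub, mul_assoc, hwv, mul_one, mul_one]
      have h3 : d = (1 / 2 : 𝕜) • (1 + u) := by
        rw [hu, add_sub_cancel, two_mul, ← two_smul 𝕜 d, smul_smul]
        norm_num
      rw [h2]
      calc (1 / 2 : 𝕜) • (1 + u * w) - e
          = ((1 / 2 : 𝕜) • (1 + u) - e) - (1 / 2 : 𝕜) • (u - u * w) := by module
        _ = (d - e) - (1 / 2 : 𝕜) • (u - u * w) := by rw [← h3]
    rw [h1]
    exact hdcomp.sub ((hleft hycomp).smul (1 / 2 : 𝕜))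

end IdempotentLifting

/-! ### Algebra of Cesàro means -/

section CesaroMeans

variable {𝕜 : Type u} [RCLike 𝕜] {A : Type v} [Ring A] [Algebra 𝕜 A]

theorem one_sub_mul_cesaroMean (n : ℕ) (a : A) :
    (1 - a) * cesaroMean 𝕜 n a = ((n : 𝕜) + 1)⁻¹ • (1 - a ^ (n + 1)) := by
  rw [cesaroMean, mul_smul_comm, mul_neg_geom_sum]

theorem cesaroMean_mul_one_sub (n : ℕ) (a : A) :
    cesaroMean 𝕜 n a * (1 - a) = ((n : 𝕜) + 1)⁻¹ • (1 - a ^ (n + 1)) := by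
  rw [cesaroMean, smul_mul_assoc, geom_sum_mul_neg]

theorem commute_cesaroMean (n : ℕ) (a : A) : Commute (1 - a) (cesaroMean 𝕜 n a) :=
  (one_sub_mul_cesaroMean n a).trans (cesaroMean_mul_one_sub n a).symm

/-- `1 - M_n(a)` is a multiple of `1 - a`, because each `1 - a ^ i` is. -/
theorem exists_one_sub_cesaroMean_eq (n : ℕ) (a : A) :
    ∃ q : A, Commute (1 - a) q ∧ 1 - cesaroMean 𝕜 n a = q * (1 - a) := by
  have hn : (n : 𝕜) + 1 ≠ 0 := by exact_mod_cast Nat.succ_ne_zero n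
  refine ⟨((n : 𝕜) + 1)⁻¹ • ∑ i ∈ Finset.range (n + 1), ∑ j ∈ Finset.range i, a ^ j, ?_, ?_⟩
  · refine Commute.smul_right (Commute.sum_right _ _ _ fun i _ => Commute.sum_right _ _ _
      fun j _ => ?_) _
    exact (Commute.one_left _).sub_left ((Commute.refl a).pow_right j)
  · rw [smul_mul_assoc, Finset.sum_mul]
    simp only [geom_sum_mul_neg, Finset.sum_sub_distrib, Finset.sum_const, Finset.card_range]
    rw [smul_sub, cesaroMean, nsmul_one, Nat.cast_add, Nat.cast_one]
    congr 1
    have h : ((n : A) + 1) = ((n : 𝕜) + 1) • (1 : A) := by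
      rw [add_smul, one_smul, Nat.cast_smul_eq_nsmul, nsmul_one]
    rw [h, inv_smul_smul₀ hn]

theorem cesaroMean_map {B : Type v} [Ring B] [Algebra 𝕜 B] (f : A →ₐ[𝕜] B) (n : ℕ) (a : A) :
    f (cesaroMean 𝕜 n a) = cesaroMean 𝕜 n (f a) := by
  simp [cesaroMean, map_sum]

end CesaroMeans

/-! ### The essential norm -/

section EssentialNorm

variable {𝕜 : Type u} [RCLike 𝕜] {X : Type v} [NormedAddCommGroup X] [NormedSpace 𝕜 X]

theorem toCalkin_eq_zero_iff {A : X →L[𝕜] X} : toCalkin A = 0 ↔ IsCompactOperator A :=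
  Ideal.Quotient.eq_zero_iff_mem

theorem toCalkin_eq_iff {A B : X →L[𝕜] X} : toCalkin A = toCalkin B ↔ IsCompactOperator (A - B) :=
  Ideal.Quotient.mk_eq_mk_iff_sub_mem A B

theorem toCalkin_mul (A B : X →L[𝕜] X) : toCalkin (A * B) = toCalkin A * toCalkin B := rfl

theorem toCalkin_sub (A B : X →L[𝕜] X) : toCalkin (A - B) = toCalkin A - toCalkin B := rfl

theorem toCalkin_one : toCalkin (1 : X →L[𝕜] X) = 1 := rfl

theorem toCalkin_pow (A : X →L[𝕜] X) (n : ℕ) : toCalkin (A ^ n) = toCalkin A ^ n := rfl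

theorem toCalkin_cesaroMean (n : ℕ) (T : X →L[𝕜] X) :
    toCalkin (cesaroMean 𝕜 n T) = cesaroMean 𝕜 n (toCalkin T) := by
  change Submodule.mkQ (compactIdeal 𝕜 X) _ = _
  simp only [cesaroMean]
  change ((n : 𝕜) + 1)⁻¹ • Submodule.mkQ (compactIdeal 𝕜 X) (∑ i ∈ Finset.range (n + 1), T ^ i) = _
  rw [map_sum]
  rfl

theorem essNorm_nonneg (A : X →L[𝕜] X) : 0 ≤ essNorm A := norm_nonneg (toCalkin A)

theorem essNorm_le_of_sub {A B : X →L[𝕜] X} (h : IsCompactOperator (A - B)) : essNorm A ≤ ‖B‖ := by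
  rw [essNorm, toCalkin_eq_iff.2 h]
  exact Submodule.Quotient.norm_mk_le (S := compactIdeal 𝕜 X) B

theorem exists_sub_norm_lt (A : X →L[𝕜] X) {r : ℝ} (h : essNorm A < r) :
    ∃ B : X →L[𝕜] X, IsCompactOperator (A - B) ∧ ‖B‖ < r := by
  obtain ⟨B, hB, hlt⟩ := Submodule.Quotient.norm_mk_lt (S := compactIdeal 𝕜 X) (toCalkin A)
    (sub_pos.2 h)
  refine ⟨B, toCalkin_eq_iff.1 hB.symm, ?_⟩
  rw [essNorm] at h hlt
  linarith

theorem essNorm_add_le (A B : X →L[𝕜] X) : essNorm (A + B) ≤ essNorm A + essNorm B :=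
  norm_add_le (toCalkin A) (toCalkin B)

theorem essNorm_sub_comm (A B : X →L[𝕜] X) : essNorm (A - B) = essNorm (B - A) :=
  norm_sub_rev (toCalkin A) (toCalkin B)

theorem essNorm_mul_le_left (A B : X →L[𝕜] X) : essNorm (A * B) ≤ ‖A‖ * essNorm B := by
  refine le_of_forall_pos_lt_add fun ε hε => ?_
  obtain ⟨B', hB', hlt⟩ := exists_sub_norm_lt B (r := essNorm B + ε / (‖A‖ + 1))
    (lt_add_of_pos_right _ (by positivity))
  have h1 : essNorm (A * B) ≤ ‖A * B'‖ := by
    refine essNorm_le_of_sub ?_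
    rw [← mul_sub]
    exact hB'.clm_comp A
  have h2 : ‖A * B'‖ ≤ ‖A‖ * (essNorm B + ε / (‖A‖ + 1)) :=
    (norm_mul_le _ _).trans (mul_le_mul_of_nonneg_left hlt.le (norm_nonneg _))
  have h3 : ‖A‖ * (ε / (‖A‖ + 1)) < ε := by
    rw [mul_div_assoc', div_lt_iff₀ (by positivity)]
    nlinarith [norm_nonneg A]
  linarith [mul_add ‖A‖ (essNorm B) (ε / (‖A‖ + 1))]

theorem essNorm_mul_le_right (A B : X →L[𝕜] X) : essNorm (A * B) ≤ essNorm A * ‖B‖ := by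
  refine le_of_forall_pos_lt_add fun ε hε => ?_
  obtain ⟨A', hA', hlt⟩ := exists_sub_norm_lt A (r := essNorm A + ε / (‖B‖ + 1))
    (lt_add_of_pos_right _ (by positivity))
  have h1 : essNorm (A * B) ≤ ‖A' * B‖ := by
    refine essNorm_le_of_sub ?_
    rw [← sub_mul]
    exact hA'.comp_clm B
  have h2 : ‖A' * B‖ ≤ (essNorm A + ε / (‖B‖ + 1)) * ‖B‖ :=
    (norm_mul_le _ _).trans (mul_le_mul_of_nonneg_right hlt.le (norm_nonneg _))
  have h3 : ε / (‖B‖ + 1) * ‖B‖ < ε := by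
    rw [div_mul_eq_mul_div, div_lt_iff₀ (by positivity)]
    nlinarith [norm_nonneg B]
  linarith [add_mul (essNorm A) (ε / (‖B‖ + 1)) ‖B‖]

theorem essNorm_smul_le (c : 𝕜) (A : X →L[𝕜] X) : essNorm (c • A) ≤ ‖c‖ * essNorm A := by
  have h1 : c • A = (c • (1 : X →L[𝕜] X)) * A := by rw [smul_mul_assoc, one_mul]
  have h2 : ‖c • (1 : X →L[𝕜] X)‖ ≤ ‖c‖ := by
    rw [norm_smul]
    exact mul_le_of_le_one_right (norm_nonneg c) ContinuousLinearMap.norm_id_le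
  rw [h1]
  exact (essNorm_mul_le_left _ _).trans (mul_le_mul_of_nonneg_right h2 (essNorm_nonneg A))

theorem isCompactOperator_of_essNorm_le_tendsto [CompleteSpace X] {A : X →L[𝕜] X} {u : ℕ → ℝ}
    (h : ∀ n, essNorm A ≤ u n) (hu : Tendsto u atTop (𝓝 0)) : IsCompactOperator A := by
  have h0 : essNorm A ≤ 0 := ge_of_tendsto' hu h
  have hmem : A ∈ closure {B : X →L[𝕜] X | IsCompactOperator B} := by
    rw [Metric.mem_closure_iff]
    intro ε hε
    obtain ⟨B, hB, hlt⟩ := exists_sub_norm_lt A (h0.trans_lt hε)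
    refine ⟨A - B, hB, ?_⟩
    rwa [dist_eq_norm, sub_sub_cancel]
  rwa [isClosed_setOfPred_isCompactOperator.closure_eq] at hmem

end EssentialNorm

/-! ### From convergent Cesàro means to an essentially maximal subspace -/

section Idempotent

variable {𝕜 : Type u} [RCLike 𝕜] {X : Type v} [NormedAddCommGroup X] [NormedSpace 𝕜 X]

theorem finiteDimensional_of_isCompactOperator_subtypeL {V : Submodule 𝕜 X}
    (h : IsCompactOperator V.subtypeL) : FiniteDimensional 𝕜 V := by
  by_contra hV
  obtain ⟨c, hc⟩ := NormedField.exists_one_lt_norm 𝕜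
  obtain ⟨f, hfR, hsep⟩ := exists_seq_norm_le_one_le_norm_sub' hc (lt_add_one _) hV
  obtain ⟨K, hK, hKs⟩ := h.image_closedBall_subset_compact (‖c‖ + 1)
  obtain ⟨a, -, ψ, hψ, hψa⟩ := hK.tendsto_subseq (x := fun n => V.subtypeL (f n)) (fun n =>
    hKs ⟨f n, by simpa using hfR n, rfl⟩)
  have hC := hψa.cauchySeq
  rw [Metric.cauchySeq_iff'] at hC
  obtain ⟨N, hN⟩ := hC 1 one_pos
  have h1 := hN (N + 1) (Nat.le_succ N)
  rw [dist_eq_norm] at h1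
  have h2 := hsep (hψ.injective.ne (Nat.succ_ne_self N))
  exact absurd h1 (not_lt.2 h2)

/-- If `f` is idempotent, `S f` is compact and `1 - f` is a left multiple of `S` modulo compact
operators, then on any larger subspace on which `S` is compact `1 - f` is a compact
idempotent, and so has finite rank. -/
theorem isEssentiallyMaximal_range_of_idempotent {S f H : X →L[𝕜] X} (hf : f * f = f)
    (hSf : IsCompactOperator (S * f)) (hH : IsCompactOperator (1 - f - H * S : X →L[𝕜] X)) :
    IsEssentiallyMaximal (fun N : Submodule 𝕜 X => IsCompactOn S N)
      (LinearMap.range f.toLinearMap) := by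
  have hfix : ∀ x ∈ LinearMap.range f.toLinearMap, f x = x := by
    rintro _ ⟨y, rfl⟩
    exact congrArg (fun g : X →L[𝕜] X => g y) hf
  refine ⟨?_, fun M₀ hM hM₀ => ?_⟩
  · have h1 : S.comp (LinearMap.range f.toLinearMap).subtypeL
        = (S * f).comp (LinearMap.range f.toLinearMap).subtypeL := by
      ext x
      simp [hfix x x.2]
    change IsCompactOperator _
    rw [h1]
    exact hSf.comp_clm _
  · have hc : IsCompactOperator ((1 - f : X →L[𝕜] X).comp M₀.subtypeL) := by
      have h1 : (1 - f : X →L[𝕜] X).comp M₀.subtypeL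
          = (1 - f - H * S : X →L[𝕜] X).comp M₀.subtypeL + H.comp (S.comp M₀.subtypeL) := by
        ext x; simp
      rw [h1]
      exact (hH.comp_clm _).add (IsCompactOperator.clm_comp hM₀ H)
    -- The range of `1 - f` on `M₀` lies in `M₀` because `f` maps into `M ≤ M₀`.
    set V : Submodule 𝕜 X := M₀.map (1 - f : X →L[𝕜] X).toLinearMap with hV
    have hVM : V ≤ M₀ := by
      rintro _ ⟨x, hx, rfl⟩
      exact M₀.sub_mem hx (hM ⟨x, rfl⟩)
    have hVfix : ∀ x ∈ V, (1 - f : X →L[𝕜] X) x = x := by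
      rintro _ ⟨y, -, rfl⟩
      have : (1 - f : X →L[𝕜] X) * (1 - f) = 1 - f := by
        rw [mul_sub, mul_one, sub_mul, one_mul, hf, sub_self, sub_zero]
      exact congrArg (fun g : X →L[𝕜] X => g y) this
    have hVfin : FiniteDimensional 𝕜 V := by
      refine finiteDimensional_of_isCompactOperator_subtypeL ?_
      have h1 : V.subtypeL = ((1 - f : X →L[𝕜] X).comp M₀.subtypeL).comp
          (V.subtypeL.codRestrict M₀ fun x => hVM x.2) := by
        ext x
        exact (hVfix x x.2).symm
      rw [h1]
      exact hc.comp_clm _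
    let φ : M₀ →ₗ[𝕜] V := ((1 - f : X →L[𝕜] X).toLinearMap.comp M₀.subtype).codRestrict V
      fun x => ⟨x, x.2, rfl⟩
    have hker : LinearMap.ker φ = (LinearMap.range f.toLinearMap).submoduleOf M₀ := by
      ext x
      rw [LinearMap.mem_ker, Submodule.submoduleOf, Submodule.mem_comap, Subtype.ext_iff]
      change (x : X) - f x = 0 ↔ _
      rw [sub_eq_zero]
      exact ⟨fun h => ⟨x, h.symm⟩, fun h => (hfix _ h).symm⟩
    rw [← hker]
    exact Module.Finite.of_injective ((LinearMap.ker φ).liftQ φ le_rfl)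
      (LinearMap.ker_eq_bot.1 (Submodule.ker_liftQ_eq_bot' _ _ rfl))

theorem tendsto_essNorm_one_sub_mul_cesaroMean {T : X →L[𝕜] X}
    (hT : Tendsto (fun n : ℕ => essNorm (T ^ n) / (n : ℝ)) atTop (𝓝 0)) :
    Tendsto (fun n : ℕ => essNorm ((1 - T) * cesaroMean 𝕜 n T)) atTop (𝓝 0) := by
  have h1 : Tendsto (fun n : ℕ => essNorm (T ^ (n + 1)) / ((n + 1 : ℕ) : ℝ)) atTop (𝓝 0) :=
    hT.comp (tendsto_add_atTop_nat 1)
  have h2 : Tendsto (fun n : ℕ => essNorm (1 : X →L[𝕜] X) * (1 / ((n : ℝ) + 1))) atTop (𝓝 0) := by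
    simpa using tendsto_one_div_add_atTop_nhds_zero_nat.const_mul (essNorm (1 : X →L[𝕜] X))
  refine squeeze_zero (fun n => essNorm_nonneg _) (fun n => ?_) (by simpa using h2.add h1)
  rw [one_sub_mul_cesaroMean]
  refine (essNorm_smul_le _ _).trans ?_
  rw [norm_inv]
  have h3 : ‖(n : 𝕜) + 1‖ = (n : ℝ) + 1 := by
    have : ((n : 𝕜) + 1) = ((n + 1 : ℕ) : 𝕜) := by push_cast; rfl
    rw [this, RCLike.norm_natCast]; push_cast; rfl
  have h4 : essNorm (1 - T ^ (n + 1)) ≤ essNorm (1 : X →L[𝕜] X) + essNorm (T ^ (n + 1)) :=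
    norm_sub_le (toCalkin (1 : X →L[𝕜] X)) (toCalkin (T ^ (n + 1)))
  rw [h3]
  refine (mul_le_mul_of_nonneg_left h4 (by positivity)).trans (le_of_eq ?_)
  field_simp

/-- The limit `p` of the Cesàro means is idempotent, annihilates `d = 1 - T` on both sides, and
`1 - p` is a left multiple of `d`, hence of every power of `d`. The range of an idempotent lift of
`p` is then essentially maximal. -/
theorem exists_isEssentiallyMaximal_of_tendsto_cesaroMean [CompleteSpace X] {m : ℕ} (hm : 1 ≤ m)
    {T : X →L[𝕜] X} (hT : Tendsto (fun n : ℕ => essNorm (T ^ n) / (n : ℝ)) atTop (𝓝 0))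
    {P : X →L[𝕜] X}
    (hP : Tendsto (fun n : ℕ => essNorm (cesaroMean 𝕜 n T - P)) atTop (𝓝 0)) :
    ∃ M : Submodule 𝕜 X,
      IsEssentiallyMaximal (fun N : Submodule 𝕜 X => IsCompactOn ((1 - T) ^ m) N) M := by
  have hDM := tendsto_essNorm_one_sub_mul_cesaroMean hT
  set D : X →L[𝕜] X := 1 - T with hD
  set d : CalkinAlgebra 𝕜 X := toCalkin D with hd
  set p : CalkinAlgebra 𝕜 X := toCalkin P with hp
  have hdp : d * p = 0 := by
    rw [hd, hp, ← toCalkin_mul, toCalkin_eq_zero_iff]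
    refine isCompactOperator_of_essNorm_le_tendsto (u := fun n =>
      ‖D‖ * essNorm (cesaroMean 𝕜 n T - P) + essNorm (D * cesaroMean 𝕜 n T)) (fun n => ?_)
      (by simpa using (hP.const_mul ‖D‖).add hDM)
    have h1 : D * P = D * (P - cesaroMean 𝕜 n T) + D * cesaroMean 𝕜 n T := by
      rw [← mul_add, sub_add_cancel]
    rw [h1, essNorm_sub_comm]
    exact (essNorm_add_le _ _).trans (add_le_add (essNorm_mul_le_left _ _) le_rfl)
  have hpd : p * d = 0 := by
    rw [hd, hp, ← toCalkin_mul, toCalkin_eq_zero_iff]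
    refine isCompactOperator_of_essNorm_le_tendsto (u := fun n =>
      essNorm (cesaroMean 𝕜 n T - P) * ‖D‖ + essNorm (D * cesaroMean 𝕜 n T)) (fun n => ?_)
      (by simpa using (hP.mul_const ‖D‖).add hDM)
    have h1 : P * D = (P - cesaroMean 𝕜 n T) * D + D * cesaroMean 𝕜 n T := by
      rw [(commute_cesaroMean n T).eq, ← add_mul, sub_add_cancel]
    rw [h1, essNorm_sub_comm]
    exact (essNorm_add_le _ _).trans (add_le_add (essNorm_mul_le_right _ _) le_rfl)
  have hq : ∀ n, ∃ q : CalkinAlgebra 𝕜 X, toCalkin (cesaroMean 𝕜 n T) = 1 - q * d := by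
    intro n
    obtain ⟨q, -, hq⟩ := exists_one_sub_cesaroMean_eq (𝕜 := 𝕜) n T
    refine ⟨toCalkin q, ?_⟩
    rw [hd, ← toCalkin_mul, ← hq, toCalkin_sub, toCalkin_one, sub_sub_cancel]
  -- `M_n = 1 - q d` modulo compact operators and `d p = 0`, so `M_n p = p` for every `n`.
  have hpp : p * p = p := by
    rw [eq_comm, ← sub_eq_zero, hp, ← toCalkin_mul, ← toCalkin_sub, toCalkin_eq_zero_iff]
    refine isCompactOperator_of_essNorm_le_tendsto (u := fun n =>
      essNorm (cesaroMean 𝕜 n T - P) * ‖P‖) (fun n => ?_) (by simpa using hP.mul_const ‖P‖)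
    obtain ⟨q, hq⟩ := hq n
    have h1 : toCalkin (P - P * P) = toCalkin ((cesaroMean 𝕜 n T - P) * P) := by
      rw [toCalkin_sub, toCalkin_mul, toCalkin_mul, toCalkin_sub, hq, ← hp, sub_mul, sub_mul,
        mul_assoc, hdp, one_mul, mul_zero, sub_zero]
    rw [essNorm, h1]
    exact essNorm_mul_le_right _ _
  -- For large `n`, `q d + p = 1 - (M_n - p)` is invertible.
  obtain ⟨g, q, hgq⟩ : ∃ g q : CalkinAlgebra 𝕜 X, g * (q * d + p) = 1 := by
    obtain ⟨n, hn⟩ := (hP.eventually_lt_const one_pos).exists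
    obtain ⟨B, hB, hlt⟩ := exists_sub_norm_lt _ hn
    obtain ⟨G, hG⟩ := (isUnit_one_sub_of_norm_lt_one hlt)
    obtain ⟨q, hq⟩ := hq n
    refine ⟨toCalkin (((G⁻¹ : (X →L[𝕜] X)ˣ)) : X →L[𝕜] X), q, ?_⟩
    have h1 : q * d + p = toCalkin (1 - B) := by
      have h2 : toCalkin B = toCalkin (cesaroMean 𝕜 n T) - p := (toCalkin_eq_iff.2 hB).symm
      rw [toCalkin_sub, h2, hq, toCalkin_one]
      abel
    rw [h1, ← hG, ← toCalkin_mul, Units.inv_mul, toCalkin_one]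
  have h1p : 1 - p = g * q * d := by
    calc 1 - p = g * (q * d + p) * (1 - p) := by rw [hgq, one_mul]
      _ = g * (q * (d - d * p) + (p - p * p)) := by noncomm_ring
      _ = g * q * d := by rw [hdp, hpp, sub_self, sub_zero, add_zero, mul_assoc]
  have hpow : ∀ j : ℕ, ∃ h : CalkinAlgebra 𝕜 X, 1 - p = h * d ^ j := by
    intro j
    induction j with
    | zero => exact ⟨1 - p, by simp⟩
    | succ j ih =>
      obtain ⟨h, hh⟩ := ih
      refine ⟨g * q * h, ?_⟩
      -- `1 - p = g q d = g q (1 - p) d`, and induction applies to the inner `1 - p`.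
      have h2 : d = (1 - p) * d := by rw [sub_mul, hpd, one_mul, sub_zero]
      rw [h1p]
      nth_rewrite 1 [h2]
      rw [hh, pow_succ]
      simp only [mul_assoc]
  obtain ⟨h, hh⟩ := hpow m
  obtain ⟨H, rfl⟩ := Ideal.Quotient.mk_surjective h
  obtain ⟨f, hff, hfP⟩ := exists_isIdempotentElem_sub_isCompactOperator (e := P) (by
    rw [← toCalkin_eq_iff, toCalkin_mul]; exact hpp)
  have hfp : toCalkin f = p := toCalkin_eq_iff.2 hfP
  refine ⟨_, isEssentiallyMaximal_range_of_idempotent (H := H) hff ?_ ?_⟩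
  · rw [← toCalkin_eq_zero_iff, toCalkin_mul, toCalkin_pow, hfp, ← hd]
    obtain ⟨j, rfl⟩ := Nat.exists_eq_add_of_le' hm
    rw [pow_succ, mul_assoc, hdp, mul_zero]
  · rw [← toCalkin_eq_iff, toCalkin_sub, toCalkin_one, hfp, hh, toCalkin_mul, toCalkin_pow]
    rfl

end Idempotent

/-! ### Total boundedness through finite colorings -/

section FiniteColorings

variable {ι : Type*}

/-- For every `ε > 0` the index set splits into finitely many classes on each of which `d ≤ ε`. For
`d i j = dist (y i) (y j)` this says that the family `y` is totally bounded; for a general `d`, with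
no axioms assumed, the notion is stable under sums. A splitting is encoded as a coloring by natural
numbers with finite range. -/
def HasFiniteColorings (d : ι → ι → ℝ) : Prop :=
  ∀ ε > 0, ∃ c : ι → ℕ, (Set.range c).Finite ∧ ∀ i j, c i = c j → d i j ≤ ε

theorem HasFiniteColorings.add {d d' : ι → ι → ℝ} (h : HasFiniteColorings d)
    (h' : HasFiniteColorings d') : HasFiniteColorings (fun i j => d i j + d' i j) := by
  intro ε hε
  obtain ⟨c, hc, hcd⟩ := h (ε / 2) (half_pos hε)
  obtain ⟨c', hc', hcd'⟩ := h' (ε / 2) (half_pos hε)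
  refine ⟨fun i => Nat.pair (c i) (c' i), ?_, fun i j hij => ?_⟩
  · refine (hc.image2 Nat.pair hc').subset ?_
    rintro _ ⟨i, rfl⟩
    exact ⟨c i, ⟨i, rfl⟩, c' i, ⟨i, rfl⟩, rfl⟩
  · rw [Nat.pair_eq_pair] at hij
    linarith [hcd i j hij.1, hcd' i j hij.2]

theorem HasFiniteColorings.mono {d d' : ι → ι → ℝ} (h : HasFiniteColorings d)
    (hd : ∀ i j, d' i j ≤ d i j) : HasFiniteColorings d' := by
  intro ε hε
  obtain ⟨c, hc, hcd⟩ := h ε hε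
  exact ⟨c, hc, fun i j hij => (hd i j).trans (hcd i j hij)⟩

theorem hasFiniteColorings_zero : HasFiniteColorings (fun _ _ : ι => (0 : ℝ)) := fun _ hε =>
  ⟨fun _ => 0, Set.toFinite _ |>.subset (Set.range_const_subset (c := (0 : ℕ))), fun _ _ _ => hε.le⟩

theorem HasFiniteColorings.sum {κ : Type*} {d : κ → ι → ι → ℝ} (s : Finset κ)
    (h : ∀ k ∈ s, HasFiniteColorings (d k)) :
    HasFiniteColorings (fun i j => ∑ k ∈ s, d k i j) := by
  classical
  induction s using Finset.induction_on with
  | empty => simpa using hasFiniteColorings_zero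
  | insert a s ha ih =>
    simp only [Finset.sum_insert ha]
    exact (h a (by simp)).add (ih fun k hk => h k (by simp [hk]))

theorem HasFiniteColorings.const_mul {d : ι → ι → ℝ} (h : HasFiniteColorings d) {C : ℝ}
    (hC : 0 ≤ C) : HasFiniteColorings (fun i j => C * d i j) := by
  intro ε hε
  obtain ⟨c, hc, hcd⟩ := h (ε / (C + 1)) (by positivity)
  refine ⟨c, hc, fun i j hij => ?_⟩
  refine (mul_le_mul_of_nonneg_left (hcd i j hij) hC).trans ?_
  rw [mul_div_assoc', div_le_iff₀ (by positivity)]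
  nlinarith

/-- Choosing a representative in each class moves every index to one of finitely many indices. -/
theorem HasFiniteColorings.exists_retraction {d : ι → ι → ℝ} (h : HasFiniteColorings d) {ε : ℝ}
    (hε : 0 < ε) : ∃ ρ : ι → ι, (Set.range ρ).Finite ∧ ∀ i, d i (ρ i) ≤ ε := by
  obtain ⟨c, hc, hcd⟩ := h ε hε
  have hr : ∀ k : Set.range c, ∃ i, c i = k := fun k => k.2
  choose r hr using hr
  have : Finite (Set.range c) := hc
  refine ⟨fun i => r ⟨c i, i, rfl⟩, (Set.finite_range r).subset ?_, fun i => hcd _ _ ?_⟩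
  · rintro _ ⟨i, rfl⟩
    exact ⟨_, rfl⟩
  · rw [hr]

theorem totallyBounded_range_of_finite_approx {E : Type*} [PseudoMetricSpace E] {y : ι → E}
    (h : ∀ ε > 0, ∃ y' : ι → E, (Set.range y').Finite ∧ ∀ i, dist (y i) (y' i) ≤ ε) :
    TotallyBounded (Set.range y) := by
  rw [Metric.totallyBounded_iff]
  intro ε hε
  obtain ⟨y', hy', hd⟩ := h (ε / 2) (half_pos hε)
  refine ⟨Set.range y', hy', ?_⟩
  rintro _ ⟨i, rfl⟩
  simp only [Set.mem_iUnion]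
  exact ⟨y' i, ⟨i, rfl⟩, by rw [Metric.mem_ball]; linarith [hd i]⟩

theorem totallyBounded_range_iff_hasFiniteColorings {E : Type*} [PseudoMetricSpace E] {y : ι → E} :
    TotallyBounded (Set.range y) ↔ HasFiniteColorings fun i j => dist (y i) (y j) := by
  constructor
  · intro h ε hε
    obtain ⟨t, ht, hyt⟩ := Metric.totallyBounded_iff.1 h (ε / 2) (half_pos hε)
    have hz : ∀ i, ∃ z : t, dist (y i) z < ε / 2 := by
      intro i
      have := hyt ⟨i, rfl⟩
      simp only [Set.mem_iUnion] at this
      obtain ⟨z, hz, hd⟩ := this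
      exact ⟨⟨z, hz⟩, hd⟩
    choose z hz using hz
    have : Finite t := ht
    obtain ⟨f, hf⟩ := exists_injective_nat t
    refine ⟨fun i => f (z i), (Set.finite_range f).subset ?_, fun i j hij => ?_⟩
    · rintro _ ⟨i, rfl⟩
      exact ⟨_, rfl⟩
    · have h1 := hz i
      have h2 := hz j
      rw [← hf hij] at h2
      have := dist_triangle_right (y i) (y j) (z i)
      linarith
  · intro h
    refine totallyBounded_range_of_finite_approx fun ε hε => ?_
    obtain ⟨ρ, hρ, hd⟩ := h.exists_retraction hε
    refine ⟨fun i => y (ρ i), (hρ.image y).subset ?_, hd⟩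
    rintro _ ⟨i, rfl⟩
    exact ⟨ρ i, ⟨i, rfl⟩, rfl⟩

/-- A totally bounded family lifts to a totally bounded family through a bounded operator that has a
bounded (possibly nonlinear) section `l`: the differences of successive finite approximations are
lifted one by one and summed. -/
theorem totallyBounded_range_lift {𝕜 : Type*} [NontriviallyNormedField 𝕜] {E F : Type*}
    [NormedAddCommGroup E] [NormedSpace 𝕜 E] [CompleteSpace E] [NormedAddCommGroup F]
    [NormedSpace 𝕜 F] (π : E →L[𝕜] F) {l : F → E} (hl : ∀ y, π (l y) = y) {C : ℝ}
    (hlC : ∀ y, ‖l y‖ ≤ C * ‖y‖) {a : ι → F} (ha : TotallyBounded (Set.range a)) :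
    ∃ g : ι → E, (∀ i, π (g i) = a i) ∧ TotallyBounded (Set.range g) := by
  rw [totallyBounded_range_iff_hasFiniteColorings] at ha
  choose r hr hd using fun k : ℕ => ha.exists_retraction (ε := (1 / 2 : ℝ) ^ k) (by positivity)
  have hC : 0 ≤ |C| := abs_nonneg C
  have hlC' : ∀ y, ‖l y‖ ≤ |C| * ‖y‖ := fun y =>
    (hlC y).trans (mul_le_mul_of_nonneg_right (le_abs_self C) (norm_nonneg y))
  -- The telescoping differences `a (r (k + 1) i) - a (r k i)` take finitely many values for each `k`
  -- and are of size `2 ^ (-k)`.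
  set δ : ℕ → ι → E := fun k i => l (a (r (k + 1) i) - a (r k i)) with hδ
  have hδn : ∀ k i, ‖δ k i‖ ≤ (2 * |C|) * (1 / 2 : ℝ) ^ k := by
    intro k i
    refine (hlC' _).trans ?_
    have h1 := hd k i
    have h2 := hd (k + 1) i
    have h3 := dist_triangle_left (a (r (k + 1) i)) (a (r k i)) (a i)
    have h4 : (1 / 2 : ℝ) ^ (k + 1) ≤ (1 / 2 : ℝ) ^ k :=
      pow_le_pow_of_le_one (by norm_num) (by norm_num) (Nat.le_succ k)
    rw [← dist_eq_norm]
    nlinarith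
  have hgeo : Summable fun k : ℕ => (2 * |C|) * (1 / 2 : ℝ) ^ k :=
    (summable_geometric_of_lt_one (by norm_num) (by norm_num)).mul_left _
  have hsum : ∀ i, Summable fun k => δ k i := fun i =>
    Summable.of_norm_bounded hgeo fun k => hδn k i
  refine ⟨fun i => l (a (r 0 i)) + ∑' k, δ k i, fun i => ?_, ?_⟩
  · have h1 : ∀ n, π (l (a (r 0 i)) + ∑ k ∈ Finset.range n, δ k i) = a (r n i) := by
      intro n
      rw [map_add, map_sum]
      simp only [hδ, hl]
      rw [Finset.sum_range_sub (fun k => a (r k i))]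
      abel
    have h2 : Tendsto (fun n => π (l (a (r 0 i)) + ∑ k ∈ Finset.range n, δ k i)) atTop
        (𝓝 (π (l (a (r 0 i)) + ∑' k, δ k i))) :=
      (π.continuous.tendsto _).comp (((hsum i).hasSum.tendsto_sum_nat).const_add _)
    have h3 : Tendsto (fun n => a (r n i)) atTop (𝓝 (a i)) := by
      rw [tendsto_iff_dist_tendsto_zero]
      refine squeeze_zero (fun _ => dist_nonneg) (fun n => ?_)
        (tendsto_pow_atTop_nhds_zero_of_lt_one (r := (1 / 2 : ℝ)) (by norm_num) (by norm_num))
      rw [dist_comm]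
      exact hd n i
    simp only [h1] at h2
    exact tendsto_nhds_unique h2 h3
  · refine totallyBounded_range_of_finite_approx fun ε hε => ?_
    obtain ⟨n, hn⟩ := ((tendsto_sum_nat_add
      (fun k : ℕ => (2 * |C|) * (1 / 2 : ℝ) ^ k)).eventually_lt_const hε).exists
    refine ⟨fun i => l (a (r 0 i)) + ∑ k ∈ Finset.range n, δ k i, ?_, fun i => ?_⟩
    · have hfin : ∀ n, (Set.range fun i => l (a (r 0 i)) + ∑ k ∈ Finset.range n, δ k i).Finite := by
        intro n
        induction n with
        | zero =>
          refine ((hr 0).image fun j => l (a j)).subset ?_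
          rintro _ ⟨i, rfl⟩
          exact ⟨r 0 i, ⟨i, rfl⟩, by simp⟩
        | succ n ih =>
          refine (ih.image2 (· + ·) ((hr (n + 1)).image2 (fun j j' => l (a j - a j')) (hr n))).subset
            ?_
          rintro _ ⟨i, rfl⟩
          refine ⟨_, ⟨i, rfl⟩, δ n i, ⟨r (n + 1) i, ⟨i, rfl⟩, r n i, ⟨i, rfl⟩, rfl⟩, ?_⟩
          simp only [Finset.sum_range_succ, add_assoc]
      exact hfin n
    · rw [dist_add_left, dist_eq_norm, ← (hsum i).sum_add_tsum_nat_add n, add_sub_cancel_left]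
      refine (tsum_of_norm_bounded ((summable_nat_add_iff n).2 hgeo).hasSum
        fun k => hδn (k + n) i).trans hn.le

end FiniteColorings

/-! ### Precompact majorants and essentially maximal subspaces -/

section PrecompactBounds

variable {𝕜 : Type u} [RCLike 𝕜] {X : Type v} [NormedAddCommGroup X] [NormedSpace 𝕜 X]

/-- A function dominated, for every `ε > 0`, by `ε ‖x‖` plus a constant multiple of `∑ ‖f x‖` over
finitely many functionals. An operator is compact as soon as its norm is bounded by such a function
(`isCompactOperator_of_isPrecompactBound`), and the converse is
`exists_seminorm_isPrecompactBound`. -/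
def IsPrecompactBound (𝕜 : Type u) [RCLike 𝕜] {X : Type v} [NormedAddCommGroup X]
    [NormedSpace 𝕜 X] (p : X → ℝ) : Prop :=
  ∀ ε > 0, ∃ (C : ℝ) (s : Finset (StrongDual 𝕜 X)), 0 ≤ C ∧
    ∀ x, p x ≤ ε * ‖x‖ + C * ∑ f ∈ s, ‖f x‖

theorem IsPrecompactBound.add {p q : X → ℝ} (hp : IsPrecompactBound 𝕜 p)
    (hq : IsPrecompactBound 𝕜 q) : IsPrecompactBound 𝕜 (fun x => p x + q x) := by
  classical
  intro ε hε
  obtain ⟨C, s, hC, h⟩ := hp (ε / 2) (half_pos hε)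
  obtain ⟨C', s', hC', h'⟩ := hq (ε / 2) (half_pos hε)
  refine ⟨C + C', s ∪ s', by positivity, fun x => ?_⟩
  have h1 : ∑ f ∈ s, ‖f x‖ ≤ ∑ f ∈ s ∪ s', ‖f x‖ :=
    Finset.sum_le_sum_of_subset_of_nonneg Finset.subset_union_left fun _ _ _ => norm_nonneg _
  have h2 : ∑ f ∈ s', ‖f x‖ ≤ ∑ f ∈ s ∪ s', ‖f x‖ :=
    Finset.sum_le_sum_of_subset_of_nonneg Finset.subset_union_right fun _ _ _ => norm_nonneg _
  nlinarith [h x, h' x, mul_le_mul_of_nonneg_left h1 hC, mul_le_mul_of_nonneg_left h2 hC']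

theorem isPrecompactBound_sum (s : Finset (StrongDual 𝕜 X)) :
    IsPrecompactBound 𝕜 (fun x => ∑ f ∈ s, ‖f x‖) := fun ε hε =>
  ⟨1, s, zero_le_one, fun x => by
    rw [one_mul]; exact le_add_of_nonneg_left (by positivity)⟩

/-- Along a bounded family, a precompact bound of the differences is small on the classes of a finite
partition. -/
theorem IsPrecompactBound.hasFiniteColorings {p : X → ℝ} (hp : IsPrecompactBound 𝕜 p)
    {ι : Type*} {x : ι → X} {R : ℝ} (hx : ∀ i, ‖x i‖ ≤ R) :
    HasFiniteColorings fun i j => p (x i - x j) := by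
  intro ε hε
  have hR : 0 < |R| + 1 := by positivity
  obtain ⟨C, s, hC, h⟩ := hp (ε / (4 * (|R| + 1))) (by positivity)
  have h1 : HasFiniteColorings fun i j => C * ∑ f ∈ s, dist (f (x i)) (f (x j)) := by
    refine (HasFiniteColorings.sum s fun f _ => ?_).const_mul hC
    refine totallyBounded_range_iff_hasFiniteColorings.1 ?_
    refine (Bornology.IsBounded.isCompact_closure
      ((Metric.isBounded_closedBall (x := (0 : 𝕜)) (r := ‖f‖ * R)).subset ?_)).totallyBounded.subset
      subset_closure
    rintro _ ⟨i, rfl⟩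
    simpa using (f.le_opNorm (x i)).trans (mul_le_mul_of_nonneg_left (hx i) (norm_nonneg f))
  obtain ⟨c, hc, hcd⟩ := h1 (ε / 2) (half_pos hε)
  refine ⟨c, hc, fun i j hij => (h (x i - x j)).trans ?_⟩
  have h2 := hcd i j hij
  simp only [dist_eq_norm, ← map_sub] at h2
  have h3 : ‖x i - x j‖ ≤ 2 * (|R| + 1) := by
    have := norm_sub_le (x i) (x j)
    linarith [hx i, hx j, le_abs_self R]
  have h4 : ε / (4 * (|R| + 1)) * ‖x i - x j‖ ≤ ε / 2 := by
    refine (mul_le_mul_of_nonneg_left h3 (by positivity)).trans (le_of_eq ?_)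
    field_simp
    norm_num
  linarith

theorem isCompactOperator_of_isPrecompactBound {Z : Type*} [NormedAddCommGroup Z] [NormedSpace 𝕜 Z]
    [CompleteSpace Z] {M : Submodule 𝕜 X} {S : M →L[𝕜] Z} {p : X → ℝ}
    (hp : IsPrecompactBound 𝕜 p) (h : ∀ x : M, ‖S x‖ ≤ p x) : IsCompactOperator S := by
  refine (isCompactOperator_iff_isCompact_closure_image_closedBall (𝕜₁ := 𝕜) S.toLinearMap
    one_pos).2 ?_
  refine (TotallyBounded.closure ?_).isCompact_of_isClosed isClosed_closure
  have h1 := hp.hasFiniteColorings (x := fun y : Metric.closedBall (0 : M) 1 => ((y : M) : X))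
    (R := 1) fun y => by simpa using! mem_closedBall_zero_iff.1 y.2
  have h2 : TotallyBounded (Set.range fun y : Metric.closedBall (0 : M) 1 => S y) := by
    refine totallyBounded_range_iff_hasFiniteColorings.2 (h1.mono fun y z => ?_)
    rw [dist_eq_norm, ← map_sub]
    exact h _
  refine h2.subset ?_
  rintro _ ⟨y, hy, rfl⟩
  exact ⟨⟨y, hy⟩, rfl⟩

/-- Schauder's theorem: the adjoint of a compact operator is compact. -/
theorem totallyBounded_range_comp_of_isCompactOperator {Y Z : Type*} [NormedAddCommGroup Y]
    [NormedSpace 𝕜 Y] [NormedAddCommGroup Z] [NormedSpace 𝕜 Z] {S : Y →L[𝕜] Z}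
    (hS : IsCompactOperator S) :
    TotallyBounded (Set.range fun φ : Metric.closedBall (0 : StrongDual 𝕜 Z) 1 =>
      (φ : StrongDual 𝕜 Z).comp S) := by
  obtain ⟨K, hK, hKS⟩ := hS.image_closedBall_subset_compact 1
  rw [totallyBounded_range_iff_hasFiniteColorings]
  intro ε hε
  obtain ⟨t, -, ht, hKt⟩ := Metric.finite_approx_of_totallyBounded hK.totallyBounded (ε / 4)
    (by positivity)
  have h1 : HasFiniteColorings fun φ ψ : Metric.closedBall (0 : StrongDual 𝕜 Z) 1 =>
      ∑ z ∈ ht.toFinset, dist ((φ : StrongDual 𝕜 Z) z) ((ψ : StrongDual 𝕜 Z) z) := by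
    refine HasFiniteColorings.sum _ fun z _ => totallyBounded_range_iff_hasFiniteColorings.1 ?_
    refine (Bornology.IsBounded.isCompact_closure
      ((Metric.isBounded_closedBall (x := (0 : 𝕜)) (r := ‖z‖)).subset ?_)).totallyBounded.subset
      subset_closure
    rintro _ ⟨φ, rfl⟩
    have h1 := (φ : StrongDual 𝕜 Z).le_opNorm z
    have h2 : ‖(φ : StrongDual 𝕜 Z)‖ ≤ 1 := mem_closedBall_zero_iff.1 φ.2
    simpa using h1.trans (mul_le_of_le_one_left (norm_nonneg z) h2)
  obtain ⟨c, hc, hcd⟩ := h1 (ε / 4) (by positivity)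
  refine ⟨c, hc, fun φ ψ hφψ => ?_⟩
  have h2 : ‖(φ : StrongDual 𝕜 Z)‖ ≤ 1 := mem_closedBall_zero_iff.1 φ.2
  have h3 : ‖(ψ : StrongDual 𝕜 Z)‖ ≤ 1 := mem_closedBall_zero_iff.1 ψ.2
  beta_reduce
  rw [dist_eq_norm]
  refine ContinuousLinearMap.opNorm_le_of_unit_norm (𝕜 := 𝕜) hε.le fun y hy => ?_
  have hyK : S y ∈ K := hKS ⟨y, by simp [hy], rfl⟩
  have := hKt hyK
  simp only [Set.mem_iUnion] at this
  obtain ⟨z, hz, hd⟩ := this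
  rw [Metric.mem_ball, dist_eq_norm] at hd
  have h4 : dist ((φ : StrongDual 𝕜 Z) z) ((ψ : StrongDual 𝕜 Z) z) ≤ ε / 4 :=
    (Finset.single_le_sum (f := fun z => dist ((φ : StrongDual 𝕜 Z) z) ((ψ : StrongDual 𝕜 Z) z))
      (fun _ _ => dist_nonneg) (ht.mem_toFinset.2 hz)).trans (hcd φ ψ hφψ)
  rw [dist_eq_norm] at h4
  have h5 : ‖(φ : StrongDual 𝕜 Z) (S y - z)‖ ≤ ε / 4 :=
    ((φ : StrongDual 𝕜 Z).le_opNorm _).trans (by nlinarith [norm_nonneg (S y - z)])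
  have h6 : ‖(ψ : StrongDual 𝕜 Z) (S y - z)‖ ≤ ε / 4 :=
    ((ψ : StrongDual 𝕜 Z).le_opNorm _).trans (by nlinarith [norm_nonneg (S y - z)])
  have h7 : ((φ : StrongDual 𝕜 Z).comp S - (ψ : StrongDual 𝕜 Z).comp S) y =
      (φ : StrongDual 𝕜 Z) (S y - z) - (ψ : StrongDual 𝕜 Z) (S y - z) +
      ((φ : StrongDual 𝕜 Z) z - (ψ : StrongDual 𝕜 Z) z) := by
    simp only [sub_apply, ContinuousLinearMap.comp_apply, map_sub]
    ring
  rw [h7]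
  refine (norm_add_le _ _).trans ?_
  have := norm_sub_le ((φ : StrongDual 𝕜 Z) (S y - z)) ((ψ : StrongDual 𝕜 Z) (S y - z))
  linarith

/-- An operator that is compact on a subspace `M` is dominated there by a seminorm on the whole space
with the precompactness estimate: by Schauder's theorem the functionals `φ ∘ S`, `‖φ‖ ≤ 1`, form a totally
bounded family, which lifts from the dual of `M` to the dual of `X`; the seminorm is the supremum of
the lifted family. -/
theorem exists_seminorm_isPrecompactBound {Z : Type*} [NormedAddCommGroup Z] [NormedSpace 𝕜 Z]
    {M : Submodule 𝕜 X} {S : M →L[𝕜] Z} (hS : IsCompactOperator S) :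
    ∃ p : Seminorm 𝕜 X, IsPrecompactBound 𝕜 p ∧ ∀ x : M, ‖S x‖ ≤ p x := by
  choose l hl hln using fun f : StrongDual 𝕜 M => exists_extension_norm_eq M f
  let π : StrongDual 𝕜 X →L[𝕜] StrongDual 𝕜 M :=
    (ContinuousLinearMap.compL 𝕜 M X 𝕜).flip M.subtypeL
  obtain ⟨g, hg, hgt⟩ := totallyBounded_range_lift π (l := l) (C := 1)
    (fun f => by ext x; exact hl f x) (fun f => by rw [hln, one_mul])
    (totallyBounded_range_comp_of_isCompactOperator hS)
  have hgS : ∀ φ (x : M), g φ x = (φ : StrongDual 𝕜 Z) (S x) := fun φ x =>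
    congrArg (fun f : StrongDual 𝕜 M => f x) (hg φ)
  obtain ⟨R, hR⟩ := hgt.isBounded.exists_norm_le
  have hbdd : ∀ x, BddAbove (Set.range fun φ => ‖g φ x‖) := by
    refine fun x => ⟨R * ‖x‖, ?_⟩
    rintro _ ⟨φ, rfl⟩
    exact ((g φ).le_opNorm x).trans
      (mul_le_mul_of_nonneg_right (hR _ ⟨φ, rfl⟩) (norm_nonneg x))
  let P := fun φ => (normSeminorm 𝕜 𝕜).comp (g φ).toLinearMap
  have hP : BddAbove (Set.range P) := Seminorm.bddAbove_range_iff.2 hbdd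
  have happ : ∀ x, (⨆ φ, P φ) x = ⨆ φ, ‖g φ x‖ := fun x => Seminorm.iSup_apply hP
  refine ⟨⨆ φ, P φ, ?_, fun x => ?_⟩
  · intro ε hε
    rw [totallyBounded_range_iff_hasFiniteColorings] at hgt
    obtain ⟨ρ, hρ, hd⟩ := hgt.exists_retraction hε
    refine ⟨1, (hρ.image g).toFinset, zero_le_one, fun x => ?_⟩
    rw [happ, one_mul]
    refine Real.iSup_le (fun φ => ?_) (by positivity)
    have h1 : ‖g (ρ φ) x‖ ≤ ∑ f ∈ (hρ.image g).toFinset, ‖f x‖ :=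
      Finset.single_le_sum (f := fun f : StrongDual 𝕜 X => ‖f x‖) (fun _ _ => norm_nonneg _)
        ((hρ.image g).mem_toFinset.2 ⟨ρ φ, ⟨φ, rfl⟩, rfl⟩)
    have h2 : ‖(g φ - g (ρ φ)) x‖ ≤ ε * ‖x‖ :=
      ((g φ - g (ρ φ)).le_opNorm x).trans (mul_le_mul_of_nonneg_right
        (by simpa [dist_eq_norm] using hd φ) (norm_nonneg x))
    have h3 : g φ x = (g φ - g (ρ φ)) x + g (ρ φ) x := by simp
    rw [h3]
    exact (norm_add_le _ _).trans (add_le_add h2 h1)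
  · obtain ⟨φ, hφ, hφx⟩ := exists_dual_vector'' 𝕜 (S x)
    rw [happ]
    refine le_trans ?_ (le_ciSup (hbdd x) ⟨φ, by simpa using hφ⟩)
    rw [hgS]
    simp [hφx]

/-- Dependent choice with memory: a sequence can be built when each finite list of earlier, pairwise
compatible choices can be prolonged. -/
theorem exists_seq_of_forall_list {α : Type*} (R : α → α → Prop) (Q : ℕ → α → Prop)
    (h : ∀ l : List α, l.Pairwise R → ∃ a, Q l.length a ∧ ∀ b ∈ l, R a b) :
    ∃ f : ℕ → α, (∀ n, Q n (f n)) ∧ ∀ m n, m < n → R (f n) (f m) := by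
  obtain ⟨a₀, -⟩ := h [] List.Pairwise.nil
  have : Nonempty α := ⟨a₀⟩
  choose! next hQ hR using h
  let L : ℕ → List α := fun n => Nat.rec [] (fun _ l => next l :: l) n
  have hL : ∀ n, L (n + 1) = next (L n) :: L n := fun n => rfl
  have hpair : ∀ n, (L n).Pairwise R := by
    intro n
    induction n with
    | zero => exact List.Pairwise.nil
    | succ n ih => rw [hL]; exact List.pairwise_cons.2 ⟨hR _ ih, ih⟩
  have hlen : ∀ n, (L n).length = n := by
    intro n
    induction n with
    | zero => rfl
    | succ n ih => rw [hL, List.length_cons, ih]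
  have hmem : ∀ m n, m < n → next (L m) ∈ L n := by
    intro m n hmn
    induction n with
    | zero => omega
    | succ n ih =>
      rw [hL]
      rcases Nat.lt_succ_iff_lt_or_eq.1 hmn with h | rfl
      · exact List.mem_cons_of_mem _ (ih h)
      · exact List.mem_cons_self
  refine ⟨fun n => next (L n), fun n => ?_, fun m n hmn => hR _ (hpair n) _ (hmem m n hmn)⟩
  have := hQ _ (hpair n)
  rwa [hlen] at this

/-- For a finite biorthogonal system, `P x = x - ∑ f_k(x) x_k` is the projection onto the common
kernel of its functionals; the error `x - P x` is controlled by finitely many functionals in any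
seminorm. -/
theorem exists_projection_of_biorthogonal (r : Seminorm 𝕜 X) (l : List (X × StrongDual 𝕜 X))
    (hl : l.Pairwise fun a b => a.2 b.1 = 0 ∧ b.2 a.1 = 0) (h1 : ∀ a ∈ l, a.2 a.1 = 1) :
    ∃ P : X →L[𝕜] X, (∀ a ∈ l, (∀ x, a.2 (P x) = 0) ∧ P a.1 = 0) ∧
      (∀ f : StrongDual 𝕜 X, (∀ a ∈ l, f a.1 = 0) → ∀ x, f (P x) = f x) ∧
      (∀ x, (∀ a ∈ l, a.2 x = 0) → P x = x) ∧
      ∃ (C : ℝ) (s : Finset (StrongDual 𝕜 X)), 0 ≤ C ∧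
        ∀ x, r (x - P x) ≤ C * ∑ f ∈ s, ‖f x‖ := by
  classical
  induction l with
  | nil =>
    exact ⟨1, by simp, fun _ _ _ => rfl, fun _ _ => rfl, 0, ∅, le_rfl, fun x => by simp⟩
  | cons a l ih =>
    rw [List.pairwise_cons] at hl
    obtain ⟨P, hP, hf, hfix, C, s, hC, hr⟩ := ih hl.2 fun b hb => h1 b (by simp [hb])
    have ha1 : a.2 a.1 = 1 := h1 a (by simp)
    have happ : ∀ x, (P - a.2.smulRight a.1) x = P x - a.2 x • a.1 := fun x => by simp
    have haf : ∀ x, a.2 (P x) = a.2 x := hf a.2 fun b hb => (hl.1 b hb).1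
    have hPa : P a.1 = a.1 := hfix a.1 fun b hb => (hl.1 b hb).2
    refine ⟨P - a.2.smulRight a.1, ?_, ?_, ?_, C + r a.1, insert a.2 s, by positivity, ?_⟩
    · intro b hb
      rcases List.mem_cons.1 hb with rfl | hb
      · exact ⟨fun x => by rw [happ, map_sub, map_smul, ha1, haf]; simp, by
          rw [happ, hPa, ha1]; simp⟩
      · refine ⟨fun x => ?_, ?_⟩
        · rw [happ, map_sub, map_smul, (hP b hb).1, (hl.1 b hb).2]; simp
        · rw [happ, (hP b hb).2, (hl.1 b hb).1]; simp
    · intro f hfa x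
      rw [happ, map_sub, map_smul, hfa a (by simp), hf f (fun b hb => hfa b (by simp [hb]))]
      simp
    · intro x hx
      rw [happ, hx a (by simp), hfix x fun b hb => hx b (by simp [hb])]
      simp
    · intro x
      have h2 : x - (P - a.2.smulRight a.1) x = (x - P x) + a.2 x • a.1 := by rw [happ]; abel
      have h3 : ∑ f ∈ s, ‖f x‖ ≤ ∑ f ∈ insert a.2 s, ‖f x‖ :=
        Finset.sum_le_sum_of_subset_of_nonneg (Finset.subset_insert _ _)
          fun _ _ _ => norm_nonneg _
      have h4 : ‖a.2 x‖ ≤ ∑ f ∈ insert a.2 s, ‖f x‖ :=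
        Finset.single_le_sum (f := fun f : StrongDual 𝕜 X => ‖f x‖) (fun _ _ => norm_nonneg _)
          (Finset.mem_insert_self _ _)
      have h5 : r (a.2 x • a.1) = ‖a.2 x‖ * r a.1 := map_smul_eq_mul r _ _
      rw [h2]
      refine (map_add_le_add r _ _).trans ?_
      rw [h5]
      nlinarith [hr x, mul_le_mul_of_nonneg_left h3 hC,
        mul_le_mul_of_nonneg_right h4 (apply_nonneg r a.1)]

theorem exists_dual_eq_one_of_norm_mkQ_pos (M : Submodule 𝕜 X) {y : X} (hy : 0 < ‖M.mkQ y‖) :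
    ∃ f : StrongDual 𝕜 X, f y = 1 ∧ (∀ m ∈ M, f m = 0) ∧ ‖f‖ ≤ ‖M.mkQ y‖⁻¹ := by
  obtain ⟨g, hg, hgy⟩ := exists_dual_vector 𝕜 (M.mkQ y) hy.ne'
  refine ⟨((‖M.mkQ y‖⁻¹ : ℝ) : 𝕜) • g.comp M.mkQL, ?_, fun m hm => ?_, ?_⟩
  · change ((‖M.mkQ y‖⁻¹ : ℝ) : 𝕜) * g (M.mkQ y) = 1
    rw [hgy, ← RCLike.ofReal_mul, inv_mul_cancel₀ hy.ne', RCLike.ofReal_one]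
  · change ((‖M.mkQ y‖⁻¹ : ℝ) : 𝕜) * g (M.mkQ m) = 0
    have hm0 : M.mkQ m = 0 := (Submodule.Quotient.mk_eq_zero M).2 hm
    rw [hm0, map_zero, mul_zero]
  · rw [norm_smul, RCLike.norm_ofReal, abs_of_pos (inv_pos.2 hy)]
    refine mul_le_of_le_one_right (inv_pos.2 hy).le ?_
    refine ContinuousLinearMap.opNorm_le_bound _ zero_le_one fun x => ?_
    refine (g.le_opNorm _).trans ?_
    rw [hg]
    exact mul_le_mul_of_nonneg_left (Submodule.Quotient.norm_mk_le M x) zero_le_one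

/-- If the distance to `M` is not controlled by `q` together with finitely many functionals, there is
an infinite biorthogonal system, with functionals vanishing on `M`, on whose vectors `q` is
summably small. -/
theorem exists_biorthogonal_seq (M : Submodule 𝕜 X) (q : Seminorm 𝕜 X)
    (h : ∀ (C : ℝ) (s : Finset (StrongDual 𝕜 X)), ∃ x, C * (q x + ∑ f ∈ s, ‖f x‖) < ‖M.mkQ x‖) :
    ∃ (x : ℕ → X) (b : ℕ → StrongDual 𝕜 X), (∀ n, b n (x n) = 1) ∧
      (∀ i j, i ≠ j → b i (x j) = 0) ∧ (∀ n, ∀ m ∈ M, b n m = 0) ∧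
      ∀ n, ‖b n‖ * q (x n) ≤ (1 / 2) ^ n := by
  let α := {a : X × StrongDual 𝕜 X // a.2 a.1 = 1 ∧ ∀ m ∈ M, a.2 m = 0}
  obtain ⟨f, hfQ, hfR⟩ := exists_seq_of_forall_list (α := α)
    (fun a b => a.1.2 b.1.1 = 0 ∧ b.1.2 a.1.1 = 0)
    (fun n a => ‖a.1.2‖ * q a.1.1 ≤ (1 / 2) ^ n) (by
    intro l hl
    set η : ℝ := (1 / 2) ^ l.length
    have hη : 0 < η := by positivity
    obtain ⟨P, hP, -, hfix, C, s, hC, hr⟩ := exists_projection_of_biorthogonal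
      (normSeminorm 𝕜 X + q) (l.map Subtype.val) (List.pairwise_map.2 hl) (by
        intro a ha
        obtain ⟨a', -, rfl⟩ := List.mem_map.1 ha
        exact a'.2.1)
    have hPl : ∀ a ∈ l, (∀ x, a.1.2 (P x) = 0) ∧ P a.1.1 = 0 := fun a ha =>
      hP a.1 (List.mem_map.2 ⟨a, ha, rfl⟩)
    have hfix' : ∀ x, (∀ a ∈ l, a.1.2 x = 0) → P x = x := by
      refine fun x hx => hfix x fun a ha => ?_
      obtain ⟨a', ha', rfl⟩ := List.mem_map.1 ha
      exact hx a' ha'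
    -- The first term of `D` makes `P x` at least half as far from `M` as `x`; the last one makes
    -- `‖f ∘ P‖ q (P x) ≤ η`.
    set D : ℝ := 2 * C + 1 + 2 * ‖P‖ * (1 + C) / η with hD
    have hDpos : 0 < D := by positivity
    obtain ⟨x, hx⟩ := h D s
    set δ := ‖M.mkQ x‖
    set σ := ∑ f ∈ s, ‖f x‖
    have hσ : 0 ≤ σ := by positivity
    have hqx : 0 ≤ q x := apply_nonneg q x
    have hδ : 0 < δ := lt_of_le_of_lt (by positivity) hx
    have hrx : ‖x - P x‖ + q (x - P x) ≤ C * σ := hr x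
    have hσD : D * σ ≤ δ := by nlinarith
    have hE : 0 ≤ 2 * ‖P‖ * (1 + C) / η := by positivity
    have hCσ : C * σ ≤ δ / 2 := by
      have : (2 * C) * σ ≤ D * σ := mul_le_mul_of_nonneg_right (by linarith) hσ
      linarith
    have hy : δ / 2 ≤ ‖M.mkQ (P x)‖ := by
      have h1 : M.mkQ x = M.mkQ (P x) + M.mkQ (x - P x) := by rw [← map_add]; congr 1; abel
      have h2 : δ ≤ ‖M.mkQ (P x)‖ + ‖M.mkQ (x - P x)‖ := by
        rw [show δ = ‖M.mkQ x‖ from rfl, h1]; exact norm_add_le _ _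
      have h3 : ‖M.mkQ (x - P x)‖ ≤ ‖x - P x‖ := Submodule.Quotient.norm_mk_le M _
      linarith [apply_nonneg q (x - P x)]
    have hypos : 0 < ‖M.mkQ (P x)‖ := by linarith
    obtain ⟨f, hf1, hfM, hfn⟩ := exists_dual_eq_one_of_norm_mkQ_pos M hypos
    have hPM : ∀ m ∈ M, P m = m := fun m hm => hfix' m fun a _ => a.2.2 m hm
    have hPP : P (P x) = P x := hfix' _ fun a ha => (hPl a ha).1 x
    refine ⟨⟨(P x, f.comp P), ?_, fun m hm => ?_⟩, ?_, fun a ha => ⟨?_, (hPl a ha).1 x⟩⟩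
    · change f (P (P x)) = 1
      rw [hPP, hf1]
    · change f (P m) = 0
      rw [hPM m hm, hfM m hm]
    · change ‖f.comp P‖ * q (P x) ≤ η
      have h1 : q (P x) ≤ q x + C * σ := by
        have h2 : P x = x - (x - P x) := by abel
        have h3 : q (P x) ≤ q x + q (x - P x) := by
          nth_rewrite 1 [h2]; exact map_sub_le_add q _ _
        linarith [norm_nonneg (x - P x)]
      have h2 : ‖f‖ ≤ 2 / δ := by
        refine hfn.trans ?_
        rw [inv_le_comm₀ hypos (by positivity), inv_div]
        exact hy
      have h3 : ‖f.comp P‖ ≤ 2 / δ * ‖P‖ :=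
        (f.opNorm_comp_le P).trans (mul_le_mul_of_nonneg_right h2 (norm_nonneg _))
      have h4 : (2 * ‖P‖) * (q x + C * σ) ≤ η * δ := by
        have h5 : q x + C * σ ≤ (1 + C) * (q x + σ) := by nlinarith
        have h6 : 2 * ‖P‖ * (1 + C) / η * (q x + σ) ≤ δ := by
          refine le_trans ?_ hx.le
          exact mul_le_mul_of_nonneg_right (by linarith) (by positivity)
        rw [div_mul_eq_mul_div, div_le_iff₀ hη] at h6
        have h7 := mul_le_mul_of_nonneg_left h5 (by positivity : 0 ≤ 2 * ‖P‖)
        linarith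
      calc ‖f.comp P‖ * q (P x) ≤ (2 / δ * ‖P‖) * (q x + C * σ) :=
            mul_le_mul h3 h1 (apply_nonneg q _) (by positivity)
        _ = ((2 * ‖P‖) * (q x + C * σ)) / δ := by ring
        _ ≤ η := by rw [div_le_iff₀ hδ]; exact h4
    · change f (P a.1.1) = 0
      rw [(hPl a ha).2, map_zero])
  refine ⟨fun n => (f n).1.1, fun n => (f n).1.2, fun n => (f n).2.1, fun i j hij => ?_,
    fun n => (f n).2.2, hfQ⟩
  rcases lt_or_gt_of_ne hij with h | h
  · exact (hfR i j h).2
  · exact (hfR j i h).1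

/-- A biorthogonal system whose functionals vanish on `M` is linearly independent modulo `M`. -/
theorem not_finiteDimensional_quotient_of_biorthogonal {M M₀ : Submodule 𝕜 X} {x : ℕ → X}
    {b : ℕ → StrongDual 𝕜 X} (hx : ∀ n, x n ∈ M₀) (h1 : ∀ n, b n (x n) = 1)
    (h0 : ∀ i j, i ≠ j → b i (x j) = 0) (hbM : ∀ n, ∀ m ∈ M, b n m = 0) :
    ¬ FiniteDimensional 𝕜 (M₀ ⧸ M.submoduleOf M₀) := by
  intro hfin
  have hli : LinearIndependent 𝕜 fun n => (M.submoduleOf M₀).mkQ ⟨x n, hx n⟩ := by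
    rw [linearIndependent_iff']
    intro s c hc i hi
    have h2 : (M.submoduleOf M₀).mkQ (∑ j ∈ s, c j • (⟨x j, hx j⟩ : M₀)) = 0 := by
      rw [map_sum]
      simpa only [map_smul] using hc
    rw [Submodule.mkQ_apply, Submodule.Quotient.mk_eq_zero] at h2
    have h3 : b i (∑ j ∈ s, c j • x j) = 0 := by
      apply hbM i
      have h4 : ((∑ j ∈ s, c j • (⟨x j, hx j⟩ : M₀) : M₀) : X) ∈ M := h2
      simpa using h4
    rw [map_sum, Finset.sum_eq_single i (fun j _ hji => by
      rw [map_smul, h0 i j hji.symm, smul_zero]) (fun h => absurd hi h), map_smul, h1] at h3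
    simpa using h3
  have := hli.finite
  exact not_finite ℕ

theorem isPrecompactBound_tsum {b : ℕ → StrongDual 𝕜 X} {w : ℕ → ℝ} (hw : ∀ n, 0 ≤ w n)
    (hb : ∀ n, ‖b n‖ * w n ≤ (1 / 2) ^ n) :
    (∀ x, Summable fun n => ‖b n x‖ * w n) ∧
      IsPrecompactBound 𝕜 (fun x => ∑' n, ‖b n x‖ * w n) := by
  have hle : ∀ x n, ‖b n x‖ * w n ≤ (1 / 2) ^ n * ‖x‖ := by
    intro x n
    have h1 := mul_le_mul_of_nonneg_right ((b n).le_opNorm x) (hw n)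
    have h2 := mul_le_mul_of_nonneg_right (hb n) (norm_nonneg x)
    nlinarith
  have hgeo : Summable fun n : ℕ => (1 / 2 : ℝ) ^ n :=
    summable_geometric_of_lt_one (by norm_num) (by norm_num)
  have hnn : ∀ x n, 0 ≤ ‖b n x‖ * w n := fun x n => mul_nonneg (norm_nonneg _) (hw n)
  have hsum : ∀ x, Summable fun n => ‖b n x‖ * w n := fun x =>
    Summable.of_nonneg_of_le (hnn x) (hle x) (hgeo.mul_right ‖x‖)
  classical
  refine ⟨hsum, fun ε hε => ?_⟩
  obtain ⟨n, hn⟩ := ((tendsto_sum_nat_add fun k : ℕ => (1 / 2 : ℝ) ^ k).eventually_lt_const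
    hε).exists
  refine ⟨∑ k ∈ Finset.range n, w k, (Finset.range n).image b, Finset.sum_nonneg fun k _ => hw k,
    fun x => ?_⟩
  beta_reduce
  rw [← (hsum x).sum_add_tsum_nat_add n, add_comm]
  refine add_le_add ?_ ?_
  · refine (Summable.tsum_le_tsum (fun k => hle x (k + n)) ((summable_nat_add_iff n).2 (hsum x))
      (((summable_nat_add_iff n).2 hgeo).mul_right _)).trans ?_
    rw [tsum_mul_right]
    exact mul_le_mul_of_nonneg_right hn.le (norm_nonneg x)
  · rw [Finset.sum_mul]
    refine Finset.sum_le_sum fun k hk => ?_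
    rw [mul_comm]
    refine mul_le_mul_of_nonneg_left ?_ (hw k)
    exact Finset.single_le_sum (f := fun f : StrongDual 𝕜 X => ‖f x‖) (fun _ _ => norm_nonneg _)
      (Finset.mem_image_of_mem b hk)

/-- The analytic content of essential maximality: the distance to `M` is controlled by `‖S x‖` up to a
precompact error. Otherwise a biorthogonal sequence `x n`, small for `q x = ‖S x‖ + p x`, could be
adjoined to `M`, and `S` would still be compact on the resulting infinite-dimensional extension. -/
theorem IsEssentiallyMaximal.exists_norm_mkQ_le [CompleteSpace X] {S : X →L[𝕜] X}
    {M : Submodule 𝕜 X}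
    (hM : IsEssentiallyMaximal (fun N : Submodule 𝕜 X => IsCompactOn S N) M) :
    ∃ (C : ℝ) (p : X → ℝ), 0 ≤ C ∧ (∀ x, 0 ≤ p x) ∧ IsPrecompactBound 𝕜 p ∧
      ∀ x, ‖M.mkQ x‖ ≤ C * (‖S x‖ + p x) := by
  obtain ⟨p, hp, hpS⟩ := exists_seminorm_isPrecompactBound (S := S.comp M.subtypeL) hM.1
  set q : Seminorm 𝕜 X := (normSeminorm 𝕜 X).comp S.toLinearMap + p with hq
  have hqapp : ∀ x, q x = ‖S x‖ + p x := fun x => rfl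
  by_cases h : ∃ (C : ℝ) (s : Finset (StrongDual 𝕜 X)),
      ∀ x, ‖M.mkQ x‖ ≤ C * (q x + ∑ f ∈ s, ‖f x‖)
  · obtain ⟨C, s, hC⟩ := h
    refine ⟨|C|, fun x => p x + ∑ f ∈ s, ‖f x‖, abs_nonneg C,
      fun x => add_nonneg (apply_nonneg p x) (by positivity), hp.add (isPrecompactBound_sum s),
      fun x => (hC x).trans ?_⟩
    rw [hqapp, add_assoc]
    exact mul_le_mul_of_nonneg_right (le_abs_self C)
      (add_nonneg (norm_nonneg _) (add_nonneg (apply_nonneg p x) (by positivity)))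
  · exfalso
    push Not at h
    obtain ⟨x, b, h1, h0, hbM, hbq⟩ := exists_biorthogonal_seq M q h
    set M₀ : Submodule 𝕜 X := M ⊔ Submodule.span 𝕜 (Set.range x) with hM₀
    obtain ⟨hsum, hP⟩ := isPrecompactBound_tsum (w := fun n => q (x n))
      (fun n => apply_nonneg q _) hbq
    have hxM₀ : ∀ n, x n ∈ M₀ := fun n => Submodule.mem_sup_right (Submodule.subset_span ⟨n, rfl⟩)
    refine not_finiteDimensional_quotient_of_biorthogonal hxM₀ h1 h0 hbM
      (hM.2 M₀ le_sup_left ?_)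
    refine isCompactOperator_of_isPrecompactBound (hp.add hP) ?_
    rintro ⟨y, hy⟩
    change ‖S y‖ ≤ p y + ∑' n, ‖b n y‖ * q (x n)
    obtain ⟨m, hm, z, hz, rfl⟩ := Submodule.mem_sup.1 hy
    obtain ⟨c, rfl⟩ := Finsupp.mem_span_range_iff_exists_finsupp.1 hz
    set z : X := c.sum fun i a => a • x i with hzdef
    -- The functionals `b n` read off the coefficients, so `q z ≤ ∑ ‖b n y‖ q (x n)`.
    have hbc : ∀ n, b n (m + z) = c n := by
      intro n
      rw [map_add, hbM n m hm, zero_add, hzdef, Finsupp.sum, map_sum]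
      simp only [map_smul]
      by_cases hn : n ∈ c.support
      · rw [Finset.sum_eq_single n (fun j _ hj => by rw [h0 n j hj.symm, smul_zero])
          (fun h => absurd hn h), h1, smul_eq_mul, mul_one]
      · rw [Finset.sum_eq_zero fun j hj => by
          rw [h0 n j (fun h => hn (h ▸ hj)), smul_zero], Finsupp.notMem_support_iff.1 hn]
    have hqz : q z ≤ ∑' n, ‖b n (m + z)‖ * q (x n) := by
      refine le_trans ?_ ((hsum (m + z)).sum_le_tsum c.support fun n _ =>
        mul_nonneg (norm_nonneg _) (apply_nonneg q _))
      simp only [hbc]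
      rw [hzdef, Finsupp.sum]
      refine (Finset.le_sum_of_subadditive q (map_zero q).le (map_add_le_add q) _ _).trans
        (Finset.sum_le_sum fun n _ => ?_)
      rw [map_smul_eq_mul]
    have h2 : ‖S m‖ ≤ p m := hpS ⟨m, hm⟩
    have h3 : p m ≤ p (m + z) + p z := by
      have := map_sub_le_add p (m + z) z
      rwa [add_sub_cancel_right] at this
    have h4 : ‖S (m + z)‖ ≤ ‖S m‖ + ‖S z‖ := by rw [map_add]; exact norm_add_le _ _
    rw [hqapp] at hqz
    linarith

end PrecompactBounds

/-! ### A uniform ergodic theorem -/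

section UniformErgodic

variable {𝕜 : Type u} [RCLike 𝕜] {Z : Type v} [NormedAddCommGroup Z] [NormedSpace 𝕜 Z]

theorem tendsto_norm_one_sub_mul_cesaroMean {V : Z →L[𝕜] Z}
    (hV : Tendsto (fun n : ℕ => ‖V ^ n‖ / (n : ℝ)) atTop (𝓝 0)) :
    Tendsto (fun n : ℕ => ‖(1 - V) * cesaroMean 𝕜 n V‖) atTop (𝓝 0) := by
  have h1 : Tendsto (fun n : ℕ => ‖V ^ (n + 1)‖ / ((n + 1 : ℕ) : ℝ)) atTop (𝓝 0) :=
    hV.comp (tendsto_add_atTop_nat 1)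
  have h2 : Tendsto (fun n : ℕ => ‖(1 : Z →L[𝕜] Z)‖ * (1 / ((n : ℝ) + 1))) atTop (𝓝 0) := by
    simpa using tendsto_one_div_add_atTop_nhds_zero_nat.const_mul ‖(1 : Z →L[𝕜] Z)‖
  refine squeeze_zero (fun n => norm_nonneg _) (fun n => ?_) (by simpa using h2.add h1)
  have h3 : ‖(n : 𝕜) + 1‖ = (n : ℝ) + 1 := by
    have : ((n : 𝕜) + 1) = ((n + 1 : ℕ) : 𝕜) := by push_cast; rfl
    rw [this, RCLike.norm_natCast]; push_cast; rfl
  rw [one_sub_mul_cesaroMean, norm_smul, norm_inv, h3]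
  refine (mul_le_mul_of_nonneg_left (norm_sub_le _ _) (by positivity)).trans (le_of_eq ?_)
  field_simp

/-- On the kernel of `(1 - V) ^ 2` one has `V ^ n w = w - n (1 - V) w`, and `‖V ^ n‖ = o(n)`. -/
theorem apply_eq_zero_of_sq_apply_eq_zero {V : Z →L[𝕜] Z}
    (hV : Tendsto (fun n : ℕ => ‖V ^ n‖ / (n : ℝ)) atTop (𝓝 0)) {w : Z}
    (hw : (1 - V) ((1 - V) w) = 0) : (1 - V) w = 0 := by
  set d := (1 - V) w with hd
  have hVd : V d = d := by
    have : d - V d = 0 := hw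
    exact (sub_eq_zero.1 this).symm
  have hVw : V w = w - d := by
    have : d = w - V w := hd
    rw [this]; abel
  have hpow : ∀ n : ℕ, (V ^ n) w = w - (n : 𝕜) • d := by
    intro n
    induction n with
    | zero => simp
    | succ n ih =>
      rw [pow_succ', mul_apply_eq_comp, ih, map_sub, map_smul, hVd, hVw]
      push_cast
      module
  have h1 : ∀ᶠ n : ℕ in atTop, ‖d‖ ≤ (‖V ^ n‖ / n) * ‖w‖ + ‖w‖ * (n : ℝ)⁻¹ := by
    filter_upwards [eventually_gt_atTop 0] with n hn
    have hn' : (0 : ℝ) < n := by exact_mod_cast hn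
    have h2 : (n : ℝ) * ‖d‖ ≤ ‖V ^ n‖ * ‖w‖ + ‖w‖ := by
      have h3 : (n : 𝕜) • d = w - (V ^ n) w := by rw [hpow]; abel
      have h4 : ‖(n : 𝕜) • d‖ = n * ‖d‖ := by rw [norm_smul, RCLike.norm_natCast]
      rw [← h4, h3]
      have := norm_sub_le w ((V ^ n) w)
      linarith [(V ^ n).le_opNorm w]
    have h5 : (‖V ^ n‖ / n) * ‖w‖ + ‖w‖ * (n : ℝ)⁻¹ = (‖V ^ n‖ * ‖w‖ + ‖w‖) / n := by
      field_simp
    rw [h5, le_div_iff₀ hn', mul_comm]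
    exact h2
  have h2 : Tendsto (fun n : ℕ => (‖V ^ n‖ / n) * ‖w‖ + ‖w‖ * (n : ℝ)⁻¹) atTop (𝓝 0) := by
    simpa using (hV.mul_const ‖w‖).add (tendsto_inv_atTop_nhds_zero_nat.const_mul ‖w‖)
  exact norm_le_zero_iff.1 (ge_of_tendsto h2 h1)

theorem apply_eq_zero_of_pow_apply_eq_zero {V : Z →L[𝕜] Z}
    (hV : Tendsto (fun n : ℕ => ‖V ^ n‖ / (n : ℝ)) atTop (𝓝 0)) (m : ℕ) {w : Z}
    (hw : ((1 - V) ^ m) w = 0) : (1 - V) w = 0 := by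
  induction m with
  | zero =>
    have : w = 0 := hw
    rw [this, map_zero]
  | succ m ih =>
    rcases m with _ | m
    · simpa using hw
    · refine ih ?_
      rw [pow_succ', mul_apply_eq_comp]
      refine apply_eq_zero_of_sq_apply_eq_zero hV ?_
      rw [pow_succ', pow_succ'] at hw
      exact hw

theorem cesaroMean_apply_of_fixed {V : Z →L[𝕜] Z} {w : Z} (hw : (1 - V) w = 0) (n : ℕ) :
    cesaroMean 𝕜 n V w = w := by
  obtain ⟨q, -, hq⟩ := exists_one_sub_cesaroMean_eq (𝕜 := 𝕜) n V
  have h1 : w - cesaroMean 𝕜 n V w = q ((1 - V) w) := congrArg (fun A : Z →L[𝕜] Z => A w) hq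
  rw [hw, map_zero, sub_eq_zero] at h1
  exact h1.symm

/-- When the distance to the kernel of `(1 - V) ^ m` is bounded by `C ‖(1 - V) ^ m z‖`, some operator `B`
with `1 - B` a multiple of `1 - V` takes every vector close to a fixed point of `V`. Indeed
`(1 - V) ^ m M_n` factors through `(1 - V) M_n`, which is small, so that for large `n` each
application of `M_n` halves `‖(1 - V) ^ m z‖`; `B` is a power of `M_n`. -/
theorem exists_approx_fixed {V : Z →L[𝕜] Z}
    (hV : Tendsto (fun n : ℕ => ‖V ^ n‖ / (n : ℝ)) atTop (𝓝 0)) {m : ℕ} (hm : 1 ≤ m) {C : ℝ}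
    (hC : 0 ≤ C) (h : ∀ z, ∃ w, ((1 - V) ^ m) w = 0 ∧ ‖z - w‖ ≤ C * ‖((1 - V) ^ m) z‖) {η : ℝ}
    (hη : 0 < η) :
    ∃ B r : Z →L[𝕜] Z, 1 - B = (1 - V) * r ∧
      ∀ z, ∃ w, (1 - V) w = 0 ∧ ‖B z - w‖ ≤ η * ‖z‖ := by
  set D : Z →L[𝕜] Z := 1 - V with hD
  obtain ⟨j, rfl⟩ := Nat.exists_eq_add_of_le' hm
  have hlim : Tendsto (fun n : ℕ => C * (‖D ^ j‖ * ‖D * cesaroMean 𝕜 n V‖)) atTop (𝓝 0) := by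
    simpa using ((tendsto_norm_one_sub_mul_cesaroMean hV).const_mul ‖D ^ j‖).const_mul C
  obtain ⟨n, hn⟩ := (hlim.eventually_lt_const (half_pos one_pos)).exists
  set M := cesaroMean 𝕜 n V with hM
  have hDM : Commute D M := commute_cesaroMean n V
  have hhalf : ∀ z, ‖(D ^ (j + 1)) (M z)‖ ≤ 1 / 2 * ‖(D ^ (j + 1)) z‖ := by
    intro z
    obtain ⟨w, hw, hzw⟩ := h z
    have h1 : (D ^ (j + 1)) (M z) = (D ^ j * (D * M)) (z - w) := by
      have h2 : D ^ j * (D * M) = M * D ^ (j + 1) := by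
        rw [← mul_assoc, ← pow_succ, (hDM.pow_left (j + 1)).eq]
      rw [h2, mul_apply_eq_comp, map_sub, hw, sub_zero]
      exact congrArg (fun A : Z →L[𝕜] Z => A z) (hDM.pow_left (j + 1)).eq
    rw [h1]
    calc ‖(D ^ j * (D * M)) (z - w)‖ ≤ ‖D ^ j * (D * M)‖ * ‖z - w‖ :=
          ContinuousLinearMap.le_opNorm _ _
      _ ≤ (‖D ^ j‖ * ‖D * M‖) * (C * ‖(D ^ (j + 1)) z‖) :=
          mul_le_mul (norm_mul_le _ _) hzw (norm_nonneg _) (by positivity)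
      _ = (C * (‖D ^ j‖ * ‖D * M‖)) * ‖(D ^ (j + 1)) z‖ := by ring
      _ ≤ 1 / 2 * ‖(D ^ (j + 1)) z‖ := mul_le_mul_of_nonneg_right hn.le (norm_nonneg _)
  have hiter : ∀ i z, ‖(D ^ (j + 1)) ((M ^ i) z)‖ ≤ (1 / 2) ^ i * ‖(D ^ (j + 1)) z‖ := by
    intro i z
    induction i with
    | zero => simp
    | succ i ih =>
      rw [pow_succ' M, mul_apply_eq_comp, pow_succ' (1 / 2 : ℝ)]
      refine (hhalf _).trans ?_
      rw [mul_assoc]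
      exact mul_le_mul_of_nonneg_left ih (by norm_num)
  have hlim2 : Tendsto (fun i : ℕ => C * (‖D ^ (j + 1)‖ * (1 / 2 : ℝ) ^ i)) atTop (𝓝 0) := by
    simpa using ((tendsto_pow_atTop_nhds_zero_of_lt_one (r := (1 / 2 : ℝ)) (by norm_num)
      (by norm_num)).const_mul ‖D ^ (j + 1)‖).const_mul C
  obtain ⟨i, hi⟩ := (hlim2.eventually_lt_const hη).exists
  obtain ⟨q, hDq, hq⟩ := exists_one_sub_cesaroMean_eq (𝕜 := 𝕜) n V
  refine ⟨M ^ i, q * ∑ k ∈ Finset.range i, M ^ k, ?_, fun z => ?_⟩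
  · rw [← mul_assoc, hDq.eq, ← hq, mul_neg_geom_sum]
  · obtain ⟨w, hw, hzw⟩ := h ((M ^ i) z)
    refine ⟨w, apply_eq_zero_of_pow_apply_eq_zero hV _ hw, hzw.trans ?_⟩
    have h1 := hiter i z
    have h2 := (D ^ (j + 1)).le_opNorm z
    calc C * ‖(D ^ (j + 1)) ((M ^ i) z)‖ ≤ C * ((1 / 2) ^ i * (‖D ^ (j + 1)‖ * ‖z‖)) :=
          mul_le_mul_of_nonneg_left (h1.trans (mul_le_mul_of_nonneg_left h2 (by positivity))) hC
      _ = (C * (‖D ^ (j + 1)‖ * (1 / 2) ^ i)) * ‖z‖ := by ring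
      _ ≤ η * ‖z‖ := mul_le_mul_of_nonneg_right hi.le (norm_nonneg z)

/-- The uniform ergodic theorem in the form needed: if the distance to the kernel of `(1 - V) ^ m` is
bounded by `C ‖(1 - V) ^ m z‖`, the Cesàro means form a Cauchy sequence in norm: they fix
`ker (1 - V)` and are small on multiples of `1 - V`. -/
theorem cauchySeq_cesaroMean {V : Z →L[𝕜] Z}
    (hV : Tendsto (fun n : ℕ => ‖V ^ n‖ / (n : ℝ)) atTop (𝓝 0)) {m : ℕ} (hm : 1 ≤ m) {C : ℝ}
    (hC : 0 ≤ C) (h : ∀ z, ∃ w, ((1 - V) ^ m) w = 0 ∧ ‖z - w‖ ≤ C * ‖((1 - V) ^ m) z‖) :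
    CauchySeq fun n => cesaroMean 𝕜 n V := by
  set M : ℕ → Z →L[𝕜] Z := fun n => cesaroMean 𝕜 n V with hM
  set D : Z →L[𝕜] Z := 1 - V with hD
  have hlim : Tendsto (fun n => ‖D * M n‖) atTop (𝓝 0) := tendsto_norm_one_sub_mul_cesaroMean hV
  have hsmall : ∀ (B r : Z →L[𝕜] Z), 1 - B = D * r → ∀ k z,
      ‖M k (z - B z)‖ ≤ ‖D * M k‖ * ‖r‖ * ‖z‖ := by
    intro B r hBr k z
    have h1 : M k (z - B z) = (D * M k * r) z := by
      rw [(commute_cesaroMean k V).eq, mul_assoc, ← hBr]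
      rfl
    rw [h1]
    refine (ContinuousLinearMap.le_opNorm _ _).trans ?_
    exact mul_le_mul_of_nonneg_right (norm_mul_le _ _) (norm_nonneg z)
  -- Uniform boundedness: with `η = 1/2`, `‖M k‖` is bounded by a constant plus `‖M k‖ / 2`.
  obtain ⟨R, hR0, hR⟩ : ∃ R : ℝ, 0 < R ∧ ∀ᶠ k in atTop, ‖M k‖ ≤ R := by
    obtain ⟨B, r, hBr, hB⟩ := exists_approx_fixed hV hm hC h (half_pos one_pos)
    refine ⟨2 * (‖r‖ + ‖B‖ + 1), by positivity, ?_⟩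
    filter_upwards [hlim.eventually_le_const one_pos] with k hk
    have h1 : ‖M k‖ ≤ ‖r‖ + ‖M k‖ * (1 / 2) + ‖B‖ + 1 / 2 := by
      refine ContinuousLinearMap.opNorm_le_bound _ (by positivity) fun z => ?_
      obtain ⟨w, hw, hzw⟩ := hB z
      have h2 : M k z = M k (z - B z) + M k (B z - w) + w := by
        rw [map_sub, map_sub, show M k w = w from cesaroMean_apply_of_fixed hw k]
        abel
      have h3 : ‖M k (z - B z)‖ ≤ ‖r‖ * ‖z‖ := by
        refine (hsmall B r hBr k z).trans (mul_le_mul_of_nonneg_right ?_ (norm_nonneg z))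
        exact mul_le_of_le_one_left (norm_nonneg r) hk
      have h4 : ‖M k (B z - w)‖ ≤ ‖M k‖ * (1 / 2 * ‖z‖) :=
        ((M k).le_opNorm _).trans (mul_le_mul_of_nonneg_left hzw (norm_nonneg _))
      have h5 : ‖w‖ ≤ ‖B‖ * ‖z‖ + 1 / 2 * ‖z‖ := by
        have h6 : w = B z - (B z - w) := by abel
        have h7 := norm_sub_le (B z) (B z - w)
        rw [← h6] at h7
        linarith [B.le_opNorm z]
      rw [h2]
      refine (norm_add₃_le).trans ?_
      linarith
    linarith
  rw [Metric.cauchySeq_iff]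
  intro ε hε
  obtain ⟨B, r, hBr, hB⟩ := exists_approx_fixed hV hm hC h (η := ε / (8 * R)) (by positivity)
  have hlim' : Tendsto (fun n => ‖D * M n‖ * ‖r‖) atTop (𝓝 0) := by
    simpa using hlim.mul_const ‖r‖
  obtain ⟨N, hN⟩ := eventually_atTop.1
    (hR.and (hlim'.eventually_le_const (show 0 < ε / 8 by positivity)))
  refine ⟨N, fun k hk l hl => ?_⟩
  obtain ⟨hk1, hk2⟩ := hN k hk
  obtain ⟨hl1, hl2⟩ := hN l hl
  rw [dist_eq_norm]
  refine lt_of_le_of_lt (ContinuousLinearMap.opNorm_le_bound _ (by positivity : 0 ≤ ε / 2)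
    fun z => ?_) (half_lt_self hε)
  obtain ⟨w, hw, hzw⟩ := hB z
  have h2 : (M k - M l) z =
      M k (z - B z) - M l (z - B z) + (M k (B z - w) - M l (B z - w)) := by
    simp only [map_sub, sub_apply]
    rw [show M k w = w from cesaroMean_apply_of_fixed hw k,
      show M l w = w from cesaroMean_apply_of_fixed hw l]
    abel
  have h3 : ∀ i, ‖M i‖ ≤ R → ‖M i (B z - w)‖ ≤ ε / 8 * ‖z‖ := by
    intro i hi
    calc ‖M i (B z - w)‖ ≤ R * (ε / (8 * R) * ‖z‖) :=
          ((M i).le_opNorm _).trans (mul_le_mul hi hzw (norm_nonneg _) hR0.le)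
      _ = ε / 8 * ‖z‖ := by field_simp
  have h4 : ∀ i, ‖D * M i‖ * ‖r‖ ≤ ε / 8 → ‖M i (z - B z)‖ ≤ ε / 8 * ‖z‖ := fun i hi =>
    (hsmall B r hBr i z).trans (mul_le_mul_of_nonneg_right hi (norm_nonneg z))
  rw [h2]
  have h5 := norm_add_le (M k (z - B z) - M l (z - B z)) (M k (B z - w) - M l (B z - w))
  have h6 := norm_sub_le (M k (z - B z)) (M l (z - B z))
  have h7 := norm_sub_le (M k (B z - w)) (M l (B z - w))
  linarith [h3 k hk1, h3 l hl1, h4 k hk2, h4 l hl2]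

end UniformErgodic

/-! ### Bounded families modulo precompact families -/

section Enlargement

open BoundedContinuousFunction

variable (𝕜 : Type u) [RCLike 𝕜] (X : Type v) [NormedAddCommGroup X] [NormedSpace 𝕜 X]

/-- The closed unit ball of `X` as a bare index set: it carries the discrete topology, so that
`UnitBall X →ᵇ X` consists of all bounded families indexed by it. -/
def UnitBall : Type v := {x : X // ‖x‖ ≤ 1}

instance : TopologicalSpace (UnitBall X) := ⊥

instance : DiscreteTopology (UnitBall X) := ⟨rfl⟩

/-- The bounded families with totally bounded range. -/
def precompactFamilies : Submodule 𝕜 (UnitBall X →ᵇ X) where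
  carrier := {f | TotallyBounded (Set.range f)}
  zero_mem' := by
    refine (Set.finite_singleton (0 : X)).totallyBounded.subset ?_
    rintro _ ⟨i, rfl⟩
    rfl
  add_mem' := by
    intro f g hf hg
    refine totallyBounded_range_iff_hasFiniteColorings.2
      (((totallyBounded_range_iff_hasFiniteColorings.1 hf).add
        (totallyBounded_range_iff_hasFiniteColorings.1 hg)).mono fun i j => ?_)
    exact dist_add_add_le _ _ _ _
  smul_mem' := by
    intro c f hf
    refine (TotallyBounded.image hf (uniformContinuous_const_smul c)).subset ?_
    rintro _ ⟨i, rfl⟩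
    exact ⟨f i, ⟨i, rfl⟩, rfl⟩

variable {𝕜 X}

instance isClosed_precompactFamilies :
    IsClosed (precompactFamilies 𝕜 X : Set (UnitBall X →ᵇ X)) := by
  refine isClosed_of_closure_subset fun f hf => ?_
  refine totallyBounded_range_of_finite_approx fun ε hε => ?_
  obtain ⟨g, hg, hfg⟩ := Metric.mem_closure_iff.1 hf (ε / 2) (half_pos hε)
  obtain ⟨ρ, hρ, hd⟩ :=
    (totallyBounded_range_iff_hasFiniteColorings.1 hg).exists_retraction (half_pos hε)
  refine ⟨fun i => g (ρ i), (hρ.image g).subset ?_, fun i => ?_⟩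
  · rintro _ ⟨i, rfl⟩
    exact ⟨ρ i, ⟨i, rfl⟩, rfl⟩
  · have h1 := dist_triangle (f i) (g i) (g (ρ i))
    have h2 := dist_coe_le_dist (f := f) (g := g) i
    linarith [hd i]

variable (𝕜 X) in
/-- Bounded families in `X`, indexed by the unit ball of `X`, modulo the totally bounded ones. -/
abbrev Enlargement : Type v := (UnitBall X →ᵇ X) ⧸ precompactFamilies 𝕜 X

theorem precompactFamilies_le_comap (A : X →L[𝕜] X) :
    precompactFamilies 𝕜 X ≤
      (precompactFamilies 𝕜 X).comap (A.compLeftContinuousBounded (UnitBall X)).toLinearMap := by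
  intro f hf
  refine (TotallyBounded.image hf A.uniformContinuous).subset ?_
  rintro _ ⟨i, rfl⟩
  exact ⟨f i, ⟨i, rfl⟩, rfl⟩

/-- The operator induced on the enlargement by applying `A` to each member of a family. -/
noncomputable def enlarge (A : X →L[𝕜] X) : Enlargement 𝕜 X →L[𝕜] Enlargement 𝕜 X :=
  LinearMap.mkContinuous ((precompactFamilies 𝕜 X).mapQ (precompactFamilies 𝕜 X)
    (A.compLeftContinuousBounded (UnitBall X)).toLinearMap (precompactFamilies_le_comap A)) ‖A‖ (by
  intro z
  refine le_of_forall_pos_le_add fun ε hε => ?_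
  obtain ⟨f, rfl, hf⟩ := Submodule.Quotient.norm_mk_lt z (ε := ε / (‖A‖ + 1)) (by positivity)
  rw [Submodule.mapQ_apply]
  refine (Submodule.Quotient.norm_mk_le _ _).trans ?_
  have h1 : ‖A.compLeftContinuousBounded (UnitBall X) f‖ ≤ ‖A‖ * ‖f‖ := by
    refine (BoundedContinuousFunction.norm_le (by positivity)).2 fun i => ?_
    exact (A.le_opNorm _).trans (mul_le_mul_of_nonneg_left (f.norm_coe_le_norm i) (norm_nonneg A))
  have h2 := mul_le_mul_of_nonneg_left hf.le (norm_nonneg A)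
  have h3 : ‖A‖ * (ε / (‖A‖ + 1)) ≤ ε := by
    rw [mul_div_assoc', div_le_iff₀ (by positivity)]
    nlinarith [norm_nonneg A]
  rw [mul_add] at h2
  exact h1.trans (h2.trans (by linarith)))

theorem enlarge_mk (A : X →L[𝕜] X) (f : UnitBall X →ᵇ X) :
    enlarge A ((precompactFamilies 𝕜 X).mkQ f) =
      (precompactFamilies 𝕜 X).mkQ (A.compLeftContinuousBounded (UnitBall X) f) := rfl

theorem norm_enlarge_le (A : X →L[𝕜] X) : ‖enlarge A‖ ≤ ‖A‖ :=
  LinearMap.mkContinuous_norm_le _ (norm_nonneg A) _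

variable (𝕜 X) in
/-- `enlarge` as a representation of the algebra `B(X)`. Its kernel contains the compact operators,
and under the bounded compact approximation property its norm controls the essential norm. -/
noncomputable def enlargeHom :
    (X →L[𝕜] X) →ₐ[𝕜] (Enlargement 𝕜 X →L[𝕜] Enlargement 𝕜 X) :=
  AlgHom.ofLinearMap
    { toFun := enlarge
      map_add' := fun A B => by
        ext z
        obtain ⟨f, rfl⟩ := (precompactFamilies 𝕜 X).mkQ_surjective z
        rw [_root_.add_apply, enlarge_mk, enlarge_mk, enlarge_mk, ← map_add]
        rfl
      map_smul' := fun c A => by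
        ext z
        obtain ⟨f, rfl⟩ := (precompactFamilies 𝕜 X).mkQ_surjective z
        rw [_root_.smul_apply, enlarge_mk, enlarge_mk, RingHom.id_apply, ← map_smul]
        rfl }
    (by
      ext z
      obtain ⟨f, rfl⟩ := (precompactFamilies 𝕜 X).mkQ_surjective z
      rfl)
    (fun A B => by
      ext z
      obtain ⟨f, rfl⟩ := (precompactFamilies 𝕜 X).mkQ_surjective z
      rfl)

theorem enlarge_eq_zero_of_isCompactOperator {A : X →L[𝕜] X} (hA : IsCompactOperator A) :
    enlarge A = 0 := by
  ext z
  obtain ⟨f, rfl⟩ := (precompactFamilies 𝕜 X).mkQ_surjective z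
  rw [enlarge_mk]
  refine (Submodule.Quotient.mk_eq_zero _).2 ?_
  obtain ⟨K, hK, hKA⟩ := hA.image_closedBall_subset_compact ‖f‖
  refine hK.totallyBounded.subset ?_
  rintro _ ⟨i, rfl⟩
  exact hKA ⟨f i, by simpa using f.norm_coe_le_norm i, rfl⟩

theorem norm_enlargeHom_le_essNorm (A : X →L[𝕜] X) : ‖enlargeHom 𝕜 X A‖ ≤ essNorm A := by
  refine le_of_forall_pos_lt_add fun ε hε => ?_
  obtain ⟨B, hB, hlt⟩ := exists_sub_norm_lt A (lt_add_of_pos_right (essNorm A) hε)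
  have h1 : enlargeHom 𝕜 X (A - B) = 0 := enlarge_eq_zero_of_isCompactOperator hB
  rw [map_sub, sub_eq_zero] at h1
  rw [h1]
  exact (norm_enlarge_le B).trans_lt hlt

/-- The class of the identity family `x ↦ x` on the unit ball is a test vector. If `A` applied to it is
within `r` of a totally bounded family, then `S α` is nearly the identity on that family for some
`α`, and the compact perturbation `(1 - S α) A` of `A` has norm at most about `(1 + sup ‖S α‖) r`. -/
theorem HasBCAP.exists_essNorm_le (hX : HasBCAP 𝕜 X) :
    ∃ C : ℝ, 0 < C ∧ ∀ A : X →L[𝕜] X, essNorm A ≤ C * ‖enlargeHom 𝕜 X A‖ := by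
  obtain ⟨Λ, _, _, _, S, hS, ⟨C, hC⟩, hlim⟩ := hX
  have hC0 : 0 ≤ C := (norm_nonneg _).trans (hC (Classical.arbitrary Λ))
  refine ⟨1 + C, by positivity, fun A => le_of_forall_pos_le_add fun ε hε => ?_⟩
  have hdiff : ∀ α (y : X), ‖y - S α y‖ ≤ (1 + C) * ‖y‖ := by
    intro α y
    have h1 := norm_sub_le y (S α y)
    have h2 := ((S α).le_opNorm y).trans (mul_le_mul_of_nonneg_right (hC α) (norm_nonneg y))
    linarith
  set η : ℝ := ε / (3 * (1 + C)) with hη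
  have hη0 : 0 < η := by positivity
  let e : UnitBall X →ᵇ X := ofNormedAddCommGroupDiscrete (fun x => x.1) 1 fun x => x.2
  have he : ‖(precompactFamilies 𝕜 X).mkQ e‖ ≤ 1 := by
    refine (Submodule.Quotient.norm_mk_le _ _).trans ?_
    exact (BoundedContinuousFunction.norm_le zero_le_one).2 fun x => x.2
  have hAe : ‖enlarge A ((precompactFamilies 𝕜 X).mkQ e)‖ ≤ ‖enlargeHom 𝕜 X A‖ := by
    refine ((enlarge A).le_opNorm _).trans ?_
    exact mul_le_of_le_one_right (norm_nonneg _) he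
  obtain ⟨g, hg, hgn⟩ := Submodule.Quotient.norm_mk_lt
    (enlarge A ((precompactFamilies 𝕜 X).mkQ e)) hη0
  have hκ : TotallyBounded (Set.range (A.compLeftContinuousBounded (UnitBall X) e - g)) :=
    (Submodule.Quotient.eq (precompactFamilies 𝕜 X)).1 hg.symm
  -- `A e - g` is a totally bounded family; a finite `η`-net `t` of it is almost fixed by `S α`.
  obtain ⟨t, ht, hκt⟩ := Metric.totallyBounded_iff.1 hκ η hη0
  obtain ⟨α, hα⟩ := ((eventually_all_finite ht).2 fun y _ =>
    (Metric.tendsto_nhds.1 (hlim y)) (ε / 3) (by positivity)).exists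
  have hcomp : IsCompactOperator (A - (1 - S α) * A : X →L[𝕜] X) := by
    have : A - (1 - S α) * A = S α * A := by rw [sub_mul, one_mul, sub_sub_cancel]
    rw [this]
    exact (hS α).comp_clm A
  refine (essNorm_le_of_sub hcomp).trans ?_
  refine ContinuousLinearMap.opNorm_le_of_unit_norm (𝕜 := 𝕜) (by positivity) fun x hx => ?_
  obtain ⟨y, hy⟩ : ∃ y, y = A x - g ⟨x, hx.le⟩ := ⟨_, rfl⟩
  have hyt : y ∈ ⋃ z ∈ t, Metric.ball z η := hκt ⟨⟨x, hx.le⟩, hy.symm⟩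
  simp only [Set.mem_iUnion] at hyt
  obtain ⟨z, hz, hyz⟩ := hyt
  rw [Metric.mem_ball, dist_eq_norm] at hyz
  have h1 : ((1 - S α) * A) x = (g ⟨x, hx.le⟩ - S α (g ⟨x, hx.le⟩)) +
      ((y - z) - S α (y - z)) + (z - S α z) := by
    have h2 : ((1 - S α) * A) x = A x - S α (A x) := rfl
    have h3 : A x = g ⟨x, hx.le⟩ + (y - z) + z := by rw [hy]; abel
    rw [h2, h3]
    simp only [map_add]
    abel
  have h4 : ‖z - S α z‖ ≤ ε / 3 := by
    have := hα z hz
    rw [dist_comm, dist_eq_norm] at this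
    exact this.le
  have h5 : (1 + C) * η = ε / 3 := by rw [hη]; field_simp
  have h6 := (hdiff α (y - z)).trans (mul_le_mul_of_nonneg_left hyz.le (by positivity))
  have h7 := (hdiff α (g ⟨x, hx.le⟩)).trans (mul_le_mul_of_nonneg_left
    ((g.norm_coe_le_norm _).trans (hgn.le.trans (add_le_add_left hAe η))) (by positivity))
  rw [mul_add] at h7
  rw [h1]
  refine norm_add₃_le.trans ?_
  linarith

/-- In the enlargement, essential maximality becomes an exact lower bound for `S` modulo its kernel:
the precompact error of `IsEssentiallyMaximal.exists_norm_mkQ_le` is absorbed by subtracting from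
a family its values at finitely many representatives. -/
theorem IsEssentiallyMaximal.exists_enlarge_apply_eq_zero [CompleteSpace X] {S : X →L[𝕜] X}
    {M : Submodule 𝕜 X}
    (hM : IsEssentiallyMaximal (fun N : Submodule 𝕜 X => IsCompactOn S N) M) :
    ∃ C : ℝ, 0 ≤ C ∧ ∀ z, ∃ w, enlargeHom 𝕜 X S w = 0 ∧
      ‖z - w‖ ≤ C * ‖enlargeHom 𝕜 X S z‖ := by
  obtain ⟨C, p, hC, hp0, hp, hCp⟩ := hM.exists_norm_mkQ_le
  refine ⟨6 * C + 1, by positivity, fun z => ?_⟩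
  set δ := ‖enlargeHom 𝕜 X S z‖ with hδ
  -- The case `δ = 0` is separate: the approximations below need room `δ > 0`.
  rcases (norm_nonneg (enlargeHom 𝕜 X S z)).eq_or_lt with h0 | hpos
  · exact ⟨z, norm_eq_zero.1 h0.symm, by rw [sub_self, norm_zero]; positivity⟩
  rw [← hδ] at hpos
  obtain ⟨f, rfl⟩ := (precompactFamilies 𝕜 X).mkQ_surjective z
  obtain ⟨g, hg, hgn⟩ := Submodule.Quotient.norm_mk_lt
    (enlarge S ((precompactFamilies 𝕜 X).mkQ f)) hpos
  have hgn' : ‖g‖ < 2 * δ := by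
    have : ‖enlarge S ((precompactFamilies 𝕜 X).mkQ f)‖ = δ := rfl
    linarith
  have hκ : TotallyBounded (Set.range (S.compLeftContinuousBounded (UnitBall X) f - g)) :=
    (Submodule.Quotient.eq (precompactFamilies 𝕜 X)).1 hg.symm
  obtain ⟨ρ, hρ, hd⟩ := ((totallyBounded_range_iff_hasFiniteColorings.1 hκ).add
    (hp.hasFiniteColorings f.norm_coe_le_norm)).exists_retraction hpos
  -- `S f` is totally bounded up to an error of norm less than `2 δ`, which gives
  -- `‖S (f i - f (ρ i))‖ + p (f i - f (ρ i)) ≤ δ + 4 δ`, bounded here by `6 δ`.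
  have hquot : ∀ i, ‖M.mkQ (f i - f (ρ i))‖ ≤ 6 * C * δ := by
    intro i
    have h1 := hd i
    rw [dist_eq_norm] at h1
    have h2 : S (f i - f (ρ i)) = (S (f i) - g i - (S (f (ρ i)) - g (ρ i))) + g i - g (ρ i) := by
      rw [map_sub]
      abel
    have h3 : ‖S (f i - f (ρ i))‖ ≤
        ‖S (f i) - g i - (S (f (ρ i)) - g (ρ i))‖ + ‖g i‖ + ‖g (ρ i)‖ := by
      rw [h2]
      exact (norm_sub_le _ _).trans (add_le_add_left (norm_add_le _ _) _)
    have h4 : ‖S (f i) - g i - (S (f (ρ i)) - g (ρ i))‖ + p (f i - f (ρ i)) ≤ δ := h1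
    have h5 : ‖S (f i - f (ρ i))‖ + p (f i - f (ρ i)) ≤ 6 * δ := by
      linarith [g.norm_coe_le_norm i, g.norm_coe_le_norm (ρ i)]
    exact (hCp _).trans ((mul_le_mul_of_nonneg_left h5 hC).trans_eq (by ring))
  choose y hy hyn using fun i => Submodule.Quotient.norm_mk_lt (M.mkQ (f i - f (ρ i))) hpos
  have hyM : ∀ i, f i - f (ρ i) - y i ∈ M := fun i => (Submodule.Quotient.eq M).1 (hy i).symm
  have hyn' : ∀ i, ‖y i‖ ≤ (6 * C + 1) * δ := fun i => by linarith [hyn i, hquot i]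
  let k : UnitBall X →ᵇ X := ofNormedAddCommGroupDiscrete y ((6 * C + 1) * δ) hyn'
  let r : UnitBall X →ᵇ X :=
    ofNormedAddCommGroupDiscrete (fun i => f (ρ i)) ‖f‖ fun i => f.norm_coe_le_norm _
  have hr : (precompactFamilies 𝕜 X).mkQ r = 0 := by
    refine (Submodule.Quotient.mk_eq_zero _).2 ((hρ.image f).totallyBounded.subset ?_)
    rintro _ ⟨i, rfl⟩
    exact ⟨ρ i, ⟨i, rfl⟩, rfl⟩
  -- The family `f - r - k` takes values in `M`, where `S` is compact, and `r` has finite range.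
  refine ⟨(precompactFamilies 𝕜 X).mkQ (f - r - k), ?_, ?_⟩
  · change enlarge S _ = 0
    rw [enlarge_mk]
    refine (Submodule.Quotient.mk_eq_zero _).2 ?_
    obtain ⟨K, hK, hKS⟩ := hM.1.image_closedBall_subset_compact ‖f - r - k‖
    refine hK.totallyBounded.subset ?_
    rintro _ ⟨i, rfl⟩
    exact hKS ⟨⟨f i - f (ρ i) - y i, hyM i⟩,
      mem_closedBall_zero_iff.2 ((f - r - k).norm_coe_le_norm i), rfl⟩
  · rw [← map_sub, show f - (f - r - k) = k + r by abel, map_add, hr, add_zero]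
    refine (Submodule.Quotient.norm_mk_le _ _).trans ?_
    exact (BoundedContinuousFunction.norm_le (by positivity)).2 hyn'

end Enlargement

/-! ### The equivalence -/

theorem theorem1p3 {𝕜 : Type u} [RCLike 𝕜] {X : Type v} [NormedAddCommGroup X]
    [NormedSpace 𝕜 X] [CompleteSpace X] (hX : HasBCAP 𝕜 X) (m : ℕ) (hm : 1 ≤ m)
    (T : X →L[𝕜] X)
    (hT : Tendsto (fun n : ℕ => essNorm (T ^ n) / (n : ℝ)) atTop (𝓝 0)) :
    (∃ P : CalkinAlgebra 𝕜 X,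
      Tendsto (fun n : ℕ => ‖cesaroMean 𝕜 n (toCalkin T) - P‖) atTop (𝓝 0)) ↔
    ∃ M : Submodule 𝕜 X,
      IsEssentiallyMaximal (fun N : Submodule 𝕜 X => IsCompactOn ((1 - T) ^ m) N) M := by
  constructor
  · rintro ⟨P, hP⟩
    obtain ⟨P, rfl⟩ := Ideal.Quotient.mk_surjective P
    refine exists_isEssentiallyMaximal_of_tendsto_cesaroMean (P := P) hm hT (hP.congr fun n => ?_)
    rw [← toCalkin_cesaroMean, essNorm, toCalkin_sub]
    rfl
  · rintro ⟨M, hM⟩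
    set V := enlargeHom 𝕜 X T with hVdef
    have hV : Tendsto (fun n : ℕ => ‖V ^ n‖ / (n : ℝ)) atTop (𝓝 0) := by
      refine squeeze_zero (fun n => by positivity) (fun n => ?_) hT
      rw [hVdef, ← map_pow]
      exact div_le_div_of_nonneg_right (norm_enlargeHom_le_essNorm _) (Nat.cast_nonneg n)
    obtain ⟨C, hC, h⟩ := hM.exists_enlarge_apply_eq_zero
    rw [map_pow, map_sub, map_one] at h
    obtain ⟨D, hD, hle⟩ := hX.exists_essNorm_le
    have hcauchy : CauchySeq fun n => cesaroMean 𝕜 n (toCalkin T) := by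
      refine Metric.cauchySeq_iff.2 fun ε hε => ?_
      obtain ⟨N, hN⟩ := Metric.cauchySeq_iff.1 (cauchySeq_cesaroMean hV hm hC h) (ε / D)
        (by positivity)
      refine ⟨N, fun k hk l hl => ?_⟩
      have h1 := hN k hk l hl
      rw [hVdef, ← cesaroMean_map, ← cesaroMean_map, dist_eq_norm, ← map_sub, lt_div_iff₀' hD]
        at h1
      rw [dist_eq_norm, ← toCalkin_cesaroMean, ← toCalkin_cesaroMean, ← toCalkin_sub]
      exact (hle _).trans_lt h1
    have : CompleteSpace (CalkinAlgebra 𝕜 X) :=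
      Submodule.Quotient.completeSpace (compactIdeal 𝕜 X)
    obtain ⟨P, hP⟩ := cauchySeq_tendsto_of_complete hcauchy
    have h2 := tendsto_iff_norm_sub_tendsto_zero.1 hP
    exact ⟨P, h2⟩
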